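/- **Hahn–Picard theorem.** Let $q,c\in\mathbb{C}$ with $0<|q|<1$, and for a meromorphic function $g$ on $\mathbb{C}$ let $$\mathcal{D}_{q,c}g(z)=\frac{g(qz+c)-g(z)}{(q-1)z+c}.$$ For $a\in\mathbb{C}\cup\{\infty\}$ and $r>0$ let $\hat n_{q,c}(r,g=a)$ denote the sum of the integers $n-\min\{n,m'\}$ over all points $z$ with $|z|<r$ and $g(z)=a$, where $n$ is the multiplicity with which $g$ takes the value $a$ at $z$, and $m'$ is the multiplicity of $z$ as a zero of $\mathcal{D}_{q,c}g$ if $a\in\mathbb{C}$, and as a zero of $\mathcal{D}_{q,c}(1/g)$ if $a=\infty$ (with $m'=0$ if $z$ is not a zero). The value $a$ is called a Hahn–Picard value of $g$ if $\hat n_{q,c}(r,g=a)=O(1)$ as $r\to\infty$. Let $g$ be a transcendental (that is, non-rational) meromorphic function on $\mathbb{C}$ of order zero, i.e. $\limsup_{r\to\infty}\log^+T(r,g)/\log r=0$, where $T(r,g)$ is the Nevanlinna characteristic. Then $g$ has at most two Hahn–Picard values in $\mathbb{C}\cup\{\infty\}$, and $g$ takes every $a\in\mathbb{C}\cup\{\infty\}$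 that is not a Hahn–Picard value at infinitely many points of $\mathbb{C}$. -/

import Mathlib

open Filter Topology Asymptotics Polynomial
open scoped Real

namespace HahnPicard

/-! A meromorphic function on the plane is a function `g : ℂ → ℂ` with `Meromorphic g`. The values
at isolated points (poles, removable singularities) carry no information, so zeros, poles and
`a`-points are read off from `meromorphicOrderAt`, which depends only on the values in punctured
neighbourhoods. The extended plane `ℂ ∪ {∞}` is `WithTop ℂ`, with `⊤` for `∞`, and the Nevanlinna
characteristic `T(r, g)` is `ValueDistribution.characteristic g ⊤ r`. -/

/-- The Hahn difference operator `g ↦ (g (q z + c) - g z) / ((q - 1) z + c)`. -/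
noncomputable def hahnDiff (q c : ℂ) (g : ℂ → ℂ) (z : ℂ) : ℂ :=
  (g (q * z + c) - g z) / ((q - 1) * z + c)

/-- The order `ρ(g) = limsup_{r → ∞} log⁺ T(r, g) / log r`, as an extended real number. -/
noncomputable def growthOrder (g : ℂ → ℂ) : EReal :=
  limsup (fun r : ℝ ↦
    ((Real.posLog (ValueDistribution.characteristic g ⊤ r) / Real.log r : ℝ) : EReal)) atTop

/-- `g` is (up to its values on a discrete closed set) a quotient of two polynomials. -/
def IsRationalFun (g : ℂ → ℂ) : Prop :=
  ∃ P Q : ℂ[X], Q ≠ 0 ∧ g =ᶠ[codiscrete ℂ] fun z ↦ P.eval z / Q.eval z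

/-- The multiplicity of `z` as a zero of the meromorphic function `h ≢ 0`; it is `0` when `z` is
not a zero of `h`, in particular when `z` is a pole. -/
noncomputable def zeroMult (h : ℂ → ℂ) (z : ℂ) : ℕ :=
  (meromorphicOrderAt h z).untop₀.toNat

/-- The multiplicity `n` with which `g` takes the value `a` at `z`: the multiplicity of the zero of
`g - a`, and of `1 / g` if `a = ∞`. It is `0` when `g z ≠ a`. -/
noncomputable def valueMult (g : ℂ → ℂ) (a : WithTop ℂ) (z : ℂ) : ℕ :=
  match a with
  | (a : ℂ) => zeroMult (fun w ↦ g w - a) z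
  | ⊤ => zeroMult (fun w ↦ 1 / g w) z

/-- The multiplicity `m'` at `z` of the zero of the Hahn difference of `g`, and of the Hahn
difference of `1 / g` if `a = ∞`. -/
noncomputable def hahnMult (q c : ℂ) (g : ℂ → ℂ) (a : WithTop ℂ) (z : ℂ) : ℕ :=
  match a with
  | (_ : ℂ) => zeroMult (hahnDiff q c g) z
  | ⊤ => zeroMult (hahnDiff q c (fun w ↦ 1 / g w)) z

/-- The Hahn type counting function `n̂_{q,c}(r, g = a)`: the sum of `n - min n m'` over the points
of the disc `|z| < r` at which `g` takes the value `a` (at all other points the term is `0`). -/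
noncomputable def hahnCounting (q c : ℂ) (g : ℂ → ℂ) (a : WithTop ℂ) (r : ℝ) : ℕ :=
  ∑ᶠ z ∈ Metric.ball (0 : ℂ) r,
    (valueMult g a z - min (valueMult g a z) (hahnMult q c g a z))

/-- `a` is a Hahn-Picard value of `g` if `n̂_{q,c}(r, g = a) = O(1)` as `r → ∞`. -/
def IsHahnPicardValue (q c : ℂ) (g : ℂ → ℂ) (a : WithTop ℂ) : Prop :=
  (fun r : ℝ ↦ (hahnCounting q c g a r : ℝ)) =O[atTop] (fun _ : ℝ ↦ (1 : ℝ))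

end HahnPicard

namespace HahnPicard

/-! ### Multiplicities along the orbits of an affine contraction -/

/-! No second main theorem is needed; the argument compares divisors along orbits of the contraction
`z ↦ q z + c`. Write `f` for `g - a` or `1 / g`. Then `f (q z + c)` is `f z` plus `(q - 1) z + c`
times the Hahn difference, so an `a`-point whose multiplicity `n` satisfies `n ≤ m'` is mapped to an
`a`-point of multiplicity at least `n` (`zeroMult_le_zeroMult_comp_affine`). For a Hahn–Picard value
this fails at finitely many points only. Backwards along an orbit the multiplicities then form an
eventually decreasing sequence of naturals, and local finiteness makes them invariant up to finitely
many points (`finite_setOf_comp_affine_ne`).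

Two such values `a`, `d` give `f = (g - a) / (g - d)`, or `f = g - a` when the second value is `∞`,
for which `f (q z + c) / f z` has finitely many zeros and poles. Order zero enters only through
`T(r, g) = O(√r)`. The Poisson–Jensen inequality carries this growth over to the proximity function
of `f (q z + c)` (`proximity_comp_affine_le`), so the quotient is a rational function `ρ`
(`exists_isRationalFun_comp_affine_eq_mul`).

A third value gives a second equation of this kind for `u f + v` with `u, v ≠ 0`. Eliminating,
either `f` is rational, or both multipliers are `1` and `f` is invariant under a contraction, hence
constant (`isRationalFun_of_comp_affine_eq_mul`). Both contradict transcendence. The claim on the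
remaining values is elementary: finitely many `a`-points bound the counting function. -/

lemma finite_setOf_succ_ne_of_antitone {a : ℕ → ℕ} (ha : Antitone a) :
    {k | a (k + 1) ≠ a k}.Finite := by
  obtain ⟨n, hn⟩ : ∃ n, ∀ m, a n ≤ a m :=
    ⟨Function.argmin a, fun m ↦ Function.argmin_le a m⟩
  refine (Set.finite_lt_nat n).subset fun k hk ↦ ?_
  by_contra h
  have h1 : n ≤ k := not_lt.mp h
  exact hk (le_antisymm (ha (Nat.le_succ k))
    ((ha h1).trans (hn (k + 1))))

/-- If a locally finite multiplicity function does not increase from `q z + c` to `z`, with finitely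
many exceptions, then it is invariant under `z ↦ q z + c`, with finitely many exceptions. -/
lemma finite_setOf_comp_affine_ne {q c : ℂ} (hq0 : 0 < ‖q‖) (hq1 : ‖q‖ < 1) {ν : ℂ → ℕ}
    (hν : ∀ r : ℝ, {z | ν z ≠ 0 ∧ ‖z‖ ≤ r}.Finite)
    (hle : {z | ν (q * z + c) < ν z}.Finite) :
    {z | ν (q * z + c) ≠ ν z}.Finite := by
  have hq : q ≠ 0 := norm_pos_iff.mp hq0
  have hq1' : q ≠ 1 := by rintro rfl; simp at hq1
  obtain ⟨p, hp⟩ : ∃ p, q * p + c = p :=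
    ⟨c / (1 - q), by field_simp [sub_ne_zero.mpr hq1'.symm]; ring⟩
  set σ : ℂ → ℂ := fun z ↦ q * z + c with hσ
  set τ : ℂ → ℂ := fun z ↦ (z - c) / q with hτ
  have hστ : Function.LeftInverse σ τ := fun z ↦ by simp only [hσ, hτ]; field_simp; ring
  have hτσ : Function.LeftInverse τ σ := fun z ↦ by simp only [hσ, hτ]; field_simp; ring
  have hσn : ∀ z, ‖σ z - p‖ = ‖q‖ * ‖z - p‖ := fun z ↦ by
    rw [← norm_mul]; congr 1; simp only [hσ]; linear_combination hp
  have hσk : ∀ k z, ‖σ^[k] z - p‖ = ‖q‖ ^ k * ‖z - p‖ := by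
    intro k z
    induction k with
    | zero => simp
    | succ k ih => rw [Function.iterate_succ_apply', hσn, ih]; ring
  have hτn : ∀ z, ‖z - p‖ ≤ ‖τ z - p‖ := fun z ↦ by
    have := hσn (τ z)
    rw [hστ z] at this
    rw [this]
    exact mul_le_of_le_one_left (norm_nonneg _) hq1.le
  have hloc : ∀ r : ℝ, {z | ν z ≠ 0 ∧ ‖z - p‖ ≤ r}.Finite := fun r ↦
    (hν (r + ‖p‖)).subset fun z hz ↦ ⟨hz.1, by
      calc ‖z‖ = ‖(z - p) + p‖ := by simp
        _ ≤ ‖z - p‖ + ‖p‖ := norm_add_le _ _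
        _ ≤ r + ‖p‖ := by linarith [hz.2]⟩
  -- All exceptions to monotonicity lie within distance `R` of the fixed point `p`.
  obtain ⟨R, hR0, hR⟩ : ∃ R : ℝ, 0 < R ∧ ∀ z, ν (σ z) < ν z → ‖z - p‖ < R := by
    obtain ⟨R, hR⟩ := (hle.image fun z ↦ ‖z - p‖).bddAbove
    refine ⟨max R 0 + 1, by positivity, fun z hz ↦ ?_⟩
    have : ‖z - p‖ ≤ R := hR ⟨z, hz, rfl⟩
    linarith [le_max_left R 0]
  -- The part of the support in a fundamental annulus: every forward orbit starting outside radius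
  -- `R` enters it on its first step inside.
  set W := {w | ν w ≠ 0 ∧ ‖w - p‖ ≤ R} ∩ {w | ‖q‖ * R ≤ ‖w - p‖} with hW
  have hWfin : W.Finite := (hloc R).inter_of_left _
  -- One backward step from distance at least `‖q‖ R` lands at distance at least `R`, where there
  -- are no exceptions.
  have hanti : ∀ w, ‖q‖ * R ≤ ‖w - p‖ → Antitone fun k ↦ ν (τ^[k] w) := by
    intro w hw
    refine antitone_nat_of_succ_le fun k ↦ ?_
    have h1 : ‖q‖ * R ≤ ‖τ^[k] w - p‖ := by
      induction k with
      | zero => exact hw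
      | succ k ih => rw [Function.iterate_succ_apply']; exact ih.trans (hτn _)
    have h2 : R ≤ ‖τ^[k + 1] w - p‖ := by
      have := hσn (τ^[k + 1] w)
      rw [Function.iterate_succ_apply', hστ] at this
      rw [Function.iterate_succ_apply']
      rw [this] at h1
      exact le_of_mul_le_mul_left h1 hq0
    by_contra hlt
    rw [not_le] at hlt
    refine absurd (hR (τ^[k + 1] w) ?_) (not_lt.mpr h2)
    rw [Function.iterate_succ_apply', hστ]
    rwa [Function.iterate_succ_apply'] at hlt
  have hfin1 : (⋃ w ∈ W, (fun k ↦ τ^[k + 1] w) ''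
      {k | ν (τ^[k + 1] w) ≠ ν (τ^[k] w)}).Finite :=
    hWfin.biUnion fun w hw ↦ (finite_setOf_succ_ne_of_antitone (hanti w hw.2)).image _
  have hfin2 : (σ ⁻¹' {z | ν z ≠ 0 ∧ ‖z - p‖ ≤ R}).Finite :=
    (hloc R).preimage hτσ.injective.injOn
  refine ((hfin1.union hfin2).union (hloc R)).subset fun z hz ↦ ?_
  by_cases hzR : ‖z - p‖ < R
  · by_cases h0 : ν z = 0
    · refine Or.inl (Or.inr ⟨fun h ↦ hz ?_, ?_⟩)
      · rw [h0]; exact h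
      · rw [hσn]
        exact (mul_le_of_le_one_left (norm_nonneg _) hq1.le).trans hzR.le
    · exact Or.inr ⟨h0, hzR.le⟩
  · rw [not_lt] at hzR
    -- Let `w` be the first iterate of `z` inside radius `R`; `z` is then recovered as a backward
    -- iterate of a point of `W`.
    have hex : ∃ k, ‖σ^[k] z - p‖ < R := by
      have : Tendsto (fun k : ℕ ↦ ‖q‖ ^ k * ‖z - p‖) atTop (𝓝 (0 * ‖z - p‖)) :=
        (tendsto_pow_atTop_nhds_zero_of_lt_one hq0.le hq1).mul_const _
      rw [zero_mul] at this
      obtain ⟨k, hk⟩ := (this.eventually_lt_const hR0).exists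
      exact ⟨k, by rwa [hσk]⟩
    classical
    obtain ⟨k, hk⟩ : ∃ k, Nat.find hex = k + 1 :=
      Nat.exists_eq_succ_of_ne_zero fun h ↦ by
        have := Nat.find_spec hex
        rw [h] at this
        exact absurd this (not_lt.mpr hzR)
    have hlt : ‖σ^[k + 1] z - p‖ < R := hk ▸ Nat.find_spec hex
    have hge : R ≤ ‖σ^[k] z - p‖ := not_lt.mp (Nat.find_min hex (by omega))
    set w := σ^[k + 1] z with hw
    have hwq : ‖q‖ * R ≤ ‖w - p‖ := by
      rw [hw, Function.iterate_succ_apply', hσn]; gcongr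
    have e1 : τ^[k + 1] w = z := hτσ.iterate (k + 1) z
    have e2 : τ^[k] w = σ z := by rw [hw, Function.iterate_succ_apply]; exact hτσ.iterate k _
    have hmono := hanti w hwq
    have hzle : ν z ≤ ν (σ z) := by
      have := hmono (Nat.le_succ k)
      simpa only [e1, e2] using this
    -- `ν z ≤ ν (σ z) ≤ ν w`, and the first inequality is strict.
    have hpos : ν w ≠ 0 := by
      have := hmono (Nat.zero_le k)
      simp only [e2, Function.iterate_zero, id] at this
      have h3 : ν (σ z) ≠ ν z := hz
      omega
    refine Or.inl (Or.inl (Set.mem_biUnion (x := w) ⟨⟨hpos, hlt.le⟩, hwq⟩ ⟨k, ?_, e1⟩))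
    rw [Set.mem_ofPred_eq, e1, e2]
    exact Ne.symm hz

/-! ### The Poisson-Jensen inequality -/

section PoissonJensen

open Real Metric MeromorphicOn InnerProductSpace ValueDistribution

variable {R : ℝ} {w u : ℂ}

/-- The Poisson integral at `w` of a function on the circle of radius `R` about the origin. -/
noncomputable def poissonIntegral (R : ℝ) (w : ℂ) (φ : ℂ → ℝ) : ℝ :=
  circleAverage (Complex.re ∘ herglotzRieszKernel 0 w * φ) 0 R

lemma continuousOn_re_herglotzRieszKernel (hw : w ∈ ball 0 R) :
    ContinuousOn (Complex.re ∘ herglotzRieszKernel 0 w) (sphere 0 |R|) :=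
  Complex.continuous_re.comp_continuousOn (continuousOn_herglotzRieszKernel_sphere hw)

lemma circleIntegrable_re_herglotzRieszKernel_mul {φ : ℂ → ℝ} (hφ : CircleIntegrable φ 0 R)
    (hw : w ∈ ball 0 R) :
    CircleIntegrable (Complex.re ∘ herglotzRieszKernel 0 w * φ) 0 R :=
  hφ.continuousOn_mul (continuousOn_re_herglotzRieszKernel hw)

lemma poissonIntegral_add {φ ψ : ℂ → ℝ} (hφ : CircleIntegrable φ 0 R)
    (hψ : CircleIntegrable ψ 0 R) (hw : w ∈ ball 0 R) :
    poissonIntegral R w (φ + ψ) = poissonIntegral R w φ + poissonIntegral R w ψ := by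
  rw [poissonIntegral, mul_add, circleAverage_add
    (circleIntegrable_re_herglotzRieszKernel_mul hφ hw)
    (circleIntegrable_re_herglotzRieszKernel_mul hψ hw)]
  rfl

lemma poissonIntegral_sum_mul {ι : Type*} (s : Finset ι) (a : ι → ℝ) {φ : ι → ℂ → ℝ}
    (hφ : ∀ i ∈ s, CircleIntegrable (φ i) 0 R) (hw : w ∈ ball 0 R) :
    poissonIntegral R w (fun z ↦ ∑ i ∈ s, a i * φ i z) =
      ∑ i ∈ s, a i * poissonIntegral R w (φ i) := by
  have h : (Complex.re ∘ herglotzRieszKernel 0 w * fun z ↦ ∑ i ∈ s, a i * φ i z) =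
      ∑ i ∈ s, a i • (Complex.re ∘ herglotzRieszKernel 0 w * φ i) := by
    ext z
    simp only [Pi.mul_apply, Finset.sum_apply, Pi.smul_apply, smul_eq_mul, Finset.mul_sum]
    exact Finset.sum_congr rfl fun i _ ↦ by ring
  rw [poissonIntegral, h, circleAverage_sum fun i hi ↦
    (circleIntegrable_re_herglotzRieszKernel_mul (hφ i hi) hw).const_smul]
  simp only [circleAverage_smul, smul_eq_mul, poissonIntegral]

/-- Harnack: for `‖w‖ ≤ R / 2` the Poisson kernel lies between `0` and `(R + ‖w‖) / (R - ‖w‖) ≤ 3`.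
-/
lemma poissonIntegral_le {φ : ℂ → ℝ} (hφ : CircleIntegrable φ 0 R)
    (hφ' : CircleIntegrable (fun z ↦ max (φ z) 0) 0 R) (hR : 0 < R) (hw : ‖w‖ ≤ R / 2) :
    poissonIntegral R w φ ≤ 3 * circleAverage (fun z ↦ max (φ z) 0) 0 R := by
  have hwR : w ∈ ball 0 R := by rw [mem_ball_zero_iff]; linarith
  rw [← smul_eq_mul, ← circleAverage_smul]
  refine circleAverage_mono (circleIntegrable_re_herglotzRieszKernel_mul hφ hwR)
    (hφ'.const_smul) fun z hz ↦ ?_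
  rw [abs_of_pos hR] at hz
  have h1 := re_herglotzRieszKernel_le hz hwR
  have h2 := le_re_herglotzRieszKernel hz hwR
  rw [sub_zero] at h1 h2
  have h3 : (R + ‖w‖) / (R - ‖w‖) ≤ 3 := by
    rw [div_le_iff₀ (by linarith)]; linarith
  have h4 : 0 ≤ (R - ‖w‖) / (R + ‖w‖) := by
    have := norm_nonneg w
    exact div_nonneg (by linarith) (by linarith)
  simp only [Pi.mul_apply, Function.comp_apply, herglotzRieszKernel_def, Pi.smul_apply,
    smul_eq_mul, sub_zero] at h1 h2 ⊢
  set k := ((z + w) / (z - w)).re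
  calc k * φ z ≤ k * max (φ z) 0 := by
        gcongr
        · exact h4.trans h2
        · exact le_max_left _ _
    _ ≤ 3 * max (φ z) 0 := by
        gcongr
        exact h1.trans h3

lemma posLog_norm_eq_max (f : ℂ → ℂ) : (fun z ↦ log⁺ ‖f z‖) = fun z ↦ max (log ‖f z‖) 0 := by
  ext z
  rw [posLog_def, max_comm]
  rfl

lemma poissonIntegral_log_norm_le_proximity {f : ℂ → ℂ} (hf : MeromorphicOn f (closedBall 0 R))
    (hR : 0 < R) (hw : ‖w‖ ≤ R / 2) :
    poissonIntegral R w (fun z ↦ log ‖f z‖) ≤ 3 * proximity f ⊤ R := by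
  have hf' : MeromorphicOn f (sphere 0 |R|) := by
    rw [abs_of_pos hR]
    exact hf.mono_set sphere_subset_closedBall
  have h := poissonIntegral_le (φ := fun z ↦ log ‖f z‖) hf'.circleIntegrable_log_norm
    (by rw [← posLog_norm_eq_max]; exact hf'.circleIntegrable_posLog_norm) hR hw
  rwa [← posLog_norm_eq_max, ← proximity_top] at h

lemma poissonIntegral_log_norm_of_ne_zero {h : ℂ → ℂ} (hh : AnalyticOnNhd ℂ h (closedBall 0 R))
    (h0 : ∀ z ∈ closedBall 0 R, h z ≠ 0) (hw : w ∈ ball 0 R) :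
    poissonIntegral R w (fun z ↦ log ‖h z‖) = log ‖h w‖ :=
  HarmonicOnNhd.circleAverage_re_herglotzRieszKernel_smul
    (fun z hz ↦ (hh z hz).harmonicAt_log_norm (h0 z hz)) hw

open scoped ComplexConjugate in
-- For `u` inside the disc, replace `z - u` by the zero-free function `B` of the same modulus on the
-- circle; the Poisson integral is then `log ‖B w‖`, and `‖w - u‖ ≤ ‖B w‖ ≤ 2 R`. For `u` on the
-- circle the Poisson formula holds for `log ‖z - u‖` itself.
lemma log_norm_sub_le_poissonIntegral (hu : u ∈ closedBall 0 R) (hw : w ∈ ball 0 R)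
    (huw : w ≠ u) :
    log ‖w - u‖ ≤ poissonIntegral R w (fun z ↦ log ‖z - u‖) ∧
      poissonIntegral R w (fun z ↦ log ‖z - u‖) ≤ log (2 * R) := by
  have hw' := mem_ball_zero_iff.mp hw
  have hu' := mem_closedBall_zero_iff.mp hu
  have hR : 0 < R := (norm_nonneg w).trans_lt hw'
  have hpos : 0 < ‖w - u‖ := norm_pos_iff.mpr (sub_ne_zero.mpr huw)
  rcases hu'.eq_or_lt with h | h
  · have := circleAverage_re_herglotzRieszKernel_mul_log (w := w) (ρ := u) (c := 0) (R := R)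
      (by simpa using h) hw
    rw [poissonIntegral, this]
    refine ⟨le_rfl, log_le_log hpos ?_⟩
    linarith [norm_sub_le w u]
  · set B : ℂ → ℂ := fun z ↦ (R ^ 2 - conj u * z) / R with hB
    have hRC : (R : ℂ) ≠ 0 := by exact_mod_cast hR.ne'
    have hBan : AnalyticOnNhd ℂ B (closedBall 0 R) := fun z _ ↦ by fun_prop (disch := exact hRC)
    have hlt : ∀ z ∈ closedBall (0 : ℂ) R, ‖conj u * z‖ < R ^ 2 := fun z hz ↦ by
      rw [norm_mul, RCLike.norm_conj, sq]
      have := mem_closedBall_zero_iff.mp hz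
      calc ‖u‖ * ‖z‖ ≤ ‖u‖ * R := by gcongr
        _ < R * R := by gcongr
    have hnR : ‖(R : ℂ) ^ 2‖ = R ^ 2 := by simp [abs_of_pos hR]
    have hB0 : ∀ z ∈ closedBall 0 R, B z ≠ 0 := fun z hz h0 ↦ by
      have h1 : (R : ℂ) ^ 2 = conj u * z := by
        rw [hB] at h0
        simpa [hRC, sub_eq_zero] using h0
      have := hlt z hz
      rw [← h1, hnR] at this
      exact lt_irrefl _ this
    have hBs : ∀ z ∈ sphere (0 : ℂ) |R|, ‖z - u‖ = ‖B z‖ := fun z hz ↦ by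
      rw [abs_of_pos hR] at hz
      have h1 := Complex.norm_canonicalFactor_eval_circle_eq_one
        (mem_ball_zero_iff.mpr h) hz
      have hzu : ‖z - u‖ ≠ 0 := norm_ne_zero_iff.mpr fun h0 ↦ by
        rw [sub_eq_zero.mp h0] at hz
        exact h.ne (mem_sphere_zero_iff_norm.mp hz)
      have hR' : ‖(R : ℂ)‖ ≠ 0 := norm_ne_zero_iff.mpr hRC
      rw [Complex.canonicalFactor_apply, norm_div, norm_mul] at h1
      rw [hB, norm_div]
      field_simp at h1 ⊢
      linarith
    have e : poissonIntegral R w (fun z ↦ log ‖z - u‖) = log ‖B w‖ := by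
      rw [← poissonIntegral_log_norm_of_ne_zero hBan hB0 hw]
      refine circleAverage_congr_sphere fun z hz ↦ ?_
      simp only [Pi.mul_apply, hBs z hz]
    have hwc := ball_subset_closedBall hw
    have hBw : ‖B w‖ = ‖(R : ℂ) ^ 2 - conj u * w‖ / R := by
      simp [hB, abs_of_pos hR]
    rw [e]
    constructor
    · refine log_le_log hpos ?_
      rw [hBw, le_div_iff₀ hR]
      refine (sq_le_sq₀ (by positivity) (norm_nonneg _)).mp ?_
      rw [mul_pow, ← Complex.normSq_eq_norm_sq, ← Complex.normSq_eq_norm_sq]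
      have h1 : Complex.normSq w ≤ R ^ 2 := by
        rw [Complex.normSq_eq_norm_sq]; gcongr
      have h2 : Complex.normSq u ≤ R ^ 2 := by
        rw [Complex.normSq_eq_norm_sq]; gcongr
      have h3 : Complex.normSq ((R : ℂ) ^ 2 - conj u * w) - Complex.normSq (w - u) * R ^ 2 =
          (R ^ 2 - Complex.normSq w) * (R ^ 2 - Complex.normSq u) := by
        rw [← Complex.ofReal_pow]
        simp only [Complex.normSq_apply, Complex.sub_re, Complex.sub_im, Complex.mul_re,
          Complex.mul_im, Complex.conj_re, Complex.conj_im, Complex.ofReal_re, Complex.ofReal_im]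
        ring
      nlinarith [mul_nonneg (sub_nonneg.mpr h1) (sub_nonneg.mpr h2)]
    · refine log_le_log (norm_pos_iff.mpr (hB0 w hwc)) ?_
      rw [hBw, div_le_iff₀ hR]
      have := norm_sub_le ((R : ℂ) ^ 2) (conj u * w)
      rw [hnR] at this
      nlinarith [hlt w hwc]

/-- **Poisson-Jensen inequality**: inside a disc, `log ‖f‖` is bounded in terms of the proximity
function and the poles of `f`. -/
theorem eventually_log_norm_le {f : ℂ → ℂ} (hf : MeromorphicOn f (closedBall 0 R))
    (hord : ∀ z : closedBall (0 : ℂ) R, meromorphicOrderAt f z ≠ ⊤) (hR : 0 < R) {S : Finset ℂ}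
    (hS : (divisor f (closedBall 0 R)).support ⊆ S) :
    ∀ᶠ w in codiscreteWithin (closedBall 0 R), ‖w‖ ≤ R / 2 →
      log ‖f w‖ ≤ 3 * proximity f ⊤ R +
        ∑ u ∈ S, ((divisor f (closedBall 0 R))⁻ u : ℝ) * (log (2 * R) - log ‖w - u‖) := by
  set D := divisor f (closedBall 0 R) with hD
  obtain ⟨h, hh, hh0, hfh⟩ := hf.extract_zeros_poles hord
    (D.finiteSupport (isCompact_closedBall 0 R))
  have hlog := MeromorphicOn.extract_zeros_poles_log hh0 hfh
  rw [← hD] at hlog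
  have hsum : (∑ᶠ u, fun z ↦ (D u : ℝ) * log ‖z - u‖) =
      fun z ↦ ∑ u ∈ S, (D u : ℝ) * log ‖z - u‖ := by
    rw [finsum_eq_sum_of_support_subset (s := S)]
    · ext z; simp
    · intro u hu
      refine hS fun h0 ↦ hu ?_
      ext z
      simp [h0]
  rw [hsum] at hlog
  have hlogS : (fun z ↦ log ‖f z‖) =ᶠ[codiscreteWithin (sphere 0 |R|)]
      (fun z ↦ ∑ u ∈ S, (D u : ℝ) * log ‖z - u‖) + fun z ↦ log ‖h z‖ := by
    rw [abs_of_pos hR]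
    exact hlog.filter_mono (codiscreteWithin_mono sphere_subset_closedBall)
  have hi : ∀ u : ℂ, CircleIntegrable (fun z ↦ log ‖z - u‖) 0 R := fun u ↦
    (analyticOnNhd_id.sub analyticOnNhd_const).meromorphicOn.circleIntegrable_log_norm
  have hih : CircleIntegrable (fun z ↦ log ‖h z‖) 0 R := by
    refine MeromorphicOn.circleIntegrable_log_norm fun z hz ↦ ?_
    rw [abs_of_pos hR] at hz
    exact (hh z (sphere_subset_closedBall hz)).meromorphicAt
  filter_upwards [hlog, codiscreteWithin_mono (Set.subset_univ (closedBall (0 : ℂ) R))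
    (S.finite_toSet.compl_mem_codiscrete)] with w hw hwS hwR
  have hwb : w ∈ ball 0 R := by rw [mem_ball_zero_iff]; linarith
  have hP : poissonIntegral R w (fun z ↦ log ‖f z‖) =
      (∑ u ∈ S, (D u : ℝ) * poissonIntegral R w fun z ↦ log ‖z - u‖) + log ‖h w‖ := by
    rw [← poissonIntegral_log_norm_of_ne_zero hh (fun z hz ↦ hh0 ⟨z, hz⟩) hwb,
      ← poissonIntegral_sum_mul S (fun u ↦ (D u : ℝ)) (fun u _ ↦ hi u) hwb,
      ← poissonIntegral_add _ hih hwb]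
    · refine circleAverage_congr_codiscreteWithin ?_ hR.ne'
      filter_upwards [hlogS] with z hz
      simp only [Pi.mul_apply, hz]
    · have : (fun z ↦ ∑ u ∈ S, (D u : ℝ) * log ‖z - u‖) =
          ∑ u ∈ S, (D u : ℝ) • fun z ↦ log ‖z - u‖ := by ext z; simp
      rw [this]
      exact CircleIntegrable.sum _ fun u _ ↦ (hi u).const_smul
  have hle := poissonIntegral_log_norm_le_proximity hf hR hwR
  rw [Pi.add_apply] at hw
  -- The zero-free factor `h` reproduces its logarithm exactly, so the whole defect comes from the
  -- linear factors.
  have hmain : log ‖f w‖ = poissonIntegral R w (fun z ↦ log ‖f z‖) +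
      ∑ u ∈ S, (D u : ℝ) * (log ‖w - u‖ - poissonIntegral R w fun z ↦ log ‖z - u‖) := by
    rw [hw, hP]
    simp only [mul_sub, Finset.sum_sub_distrib]
    ring
  rw [hmain]
  refine add_le_add hle (Finset.sum_le_sum fun u hu ↦ ?_)
  by_cases hDu : D u = 0
  · simp [hDu]
  have huR : u ∈ closedBall 0 R := D.supportWithinDomain hDu
  obtain ⟨h1, h2⟩ := log_norm_sub_le_poissonIntegral huR hwb
    (fun h ↦ hwS (h ▸ hu))
  have h3 : (D⁻ u : ℝ) = max (-(D u : ℝ)) 0 := by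
    rw [Function.locallyFinsuppWithin.negPart_apply, negPart_def]
    push_cast
    rfl
  rw [h3]
  set P := poissonIntegral R w fun z ↦ log ‖z - u‖
  have h4 : -(D u : ℝ) ≤ max (-(D u : ℝ)) 0 := le_max_left _ _
  have h5 : (0 : ℝ) ≤ max (-(D u : ℝ)) 0 := le_max_right _ _
  -- Zeros contribute a nonpositive term, as `log ‖w - u‖ ≤ P`, and are dropped; for poles `P` is
  -- bounded by `log (2 * R)`.
  calc (D u : ℝ) * (log ‖w - u‖ - P) = -(D u : ℝ) * (P - log ‖w - u‖) := by ring
    _ ≤ max (-(D u : ℝ)) 0 * (P - log ‖w - u‖) := by gcongr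
    _ ≤ max (-(D u : ℝ)) 0 * (log (2 * R) - log ‖w - u‖) := by gcongr

end PoissonJensen

/-! ### Growth under composition with an affine contraction -/

section Growth

open Real Metric MeromorphicOn InnerProductSpace ValueDistribution

variable {R : ℝ} {w u : ℂ}

/-- A pole `u ≠ 0` with `‖u‖ ≤ R` adds `log (2 R / ‖u‖) ≥ log 2` per multiplicity to the counting
function at radius `2 R`. A pole at the origin adds `log (2 R)`, which is why `1 ≤ R` is assumed. -/
lemma sum_negPart_divisor_mul_log_two_le {f : ℂ → ℂ} (hf : Meromorphic f) (hR : 1 ≤ R)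
    {S : Finset ℂ} (hS : ∀ u ∈ S, u ∈ closedBall (0 : ℂ) R) :
    ∑ u ∈ S, ((divisor f (closedBall 0 R))⁻ u : ℝ) * log 2 ≤ logCounting f ⊤ (2 * R) := by
  classical
  rw [logCounting_top]
  set E := (divisor f Set.univ)⁻ with hE
  have hE0 : 0 ≤ E := negPart_nonneg _
  have hle : ∑ u ∈ S, Function.locallyFinsuppWithin.single u (E u) ≤ E := by
    intro z
    have h1 : (∑ u ∈ S, Function.locallyFinsuppWithin.single u (E u)) z =
        ∑ u ∈ S, if z = u then E u else 0 := by
      rw [Function.locallyFinsuppWithin.coe_sum, Finset.sum_apply]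
      refine Finset.sum_congr rfl fun u _ ↦ ?_
      rw [Function.locallyFinsuppWithin.single_apply]
    rw [h1, Finset.sum_ite_eq]
    split_ifs
    · exact le_rfl
    · exact hE0 z
  refine le_trans ?_ (Function.locallyFinsuppWithin.logCounting_le hle (by linarith))
  rw [map_sum, Finset.sum_apply]
  refine Finset.sum_le_sum fun u hu ↦ ?_
  have hu' := mem_closedBall_zero_iff.mp (hS u hu)
  rw [Function.locallyFinsuppWithin.logCounting_single_eq_log_sub_const (by linarith)]
  have h2 : (divisor f (closedBall 0 R))⁻ u = E u := by
    rw [hE, Function.locallyFinsuppWithin.negPart_apply,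
      Function.locallyFinsuppWithin.negPart_apply, divisor_apply (fun z _ ↦ hf z) (hS u hu),
      divisor_apply (fun z _ ↦ hf z) (Set.mem_univ u)]
  rw [h2]
  have h3 : (0 : ℝ) ≤ E u := by exact_mod_cast hE0 u
  gcongr
  rw [log_mul two_ne_zero (by positivity)]
  have h4 : log ‖u‖ ≤ log R := by
    rcases eq_or_lt_of_le (norm_nonneg u) with h | h
    · rw [← h, log_zero]; exact log_nonneg hR
    · exact log_le_log h hu'
  linarith

lemma circleAverage_mono_codiscreteWithin {φ ψ : ℂ → ℝ} {c : ℂ} {r : ℝ} (hr : r ≠ 0)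
    (hφ : CircleIntegrable φ c r) (hψ : CircleIntegrable ψ c r)
    (h : ∀ᶠ z in codiscreteWithin (sphere c |r|), φ z ≤ ψ z) :
    circleAverage φ c r ≤ circleAverage ψ c r := by
  have hmin : φ =ᶠ[codiscreteWithin (sphere c |r|)] fun z ↦ min (φ z) (ψ z) := by
    filter_upwards [h] with z hz using (min_eq_left hz).symm
  rw [circleAverage_congr_codiscreteWithin hmin hr]
  exact circleAverage_mono (hφ.congr_codiscreteWithin hmin) hψ fun z _ ↦ min_le_right _ _

lemma eventually_comp_affine {q c : ℂ} (hq : q ≠ 0) {U V : Set ℂ} {p : ℂ → Prop}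
    (hUV : Set.MapsTo (fun z ↦ q * z + c) U V) (hp : ∀ᶠ w in codiscreteWithin V, p w) :
    ∀ᶠ z in codiscreteWithin U, p (q * z + c) := by
  refine AnalyticOnNhd.preimage_mem_codiscreteWithin (f := fun z ↦ q * z + c)
    (s := {w | p w}) (fun z _ ↦ by fun_prop) (fun z _ h ↦ ?_)
    (codiscreteWithin_mono hUV.image_subset hp)
  obtain ⟨a, ha⟩ := eventuallyConst_iff_exists_eventuallyEq.mp h
  have h1 := ha.deriv.eq_of_nhds
  have h2 : HasDerivAt (fun z ↦ q * z + c) q z := by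
    simpa using ((hasDerivAt_id z).const_mul q).add_const c
  rw [h2.deriv, deriv_const] at h1
  exact hq h1

lemma meromorphic_comp_affine {f : ℂ → ℂ} (hf : Meromorphic f) (q c : ℂ) :
    Meromorphic fun z ↦ f (q * z + c) := fun z ↦
  MeromorphicAt.comp_analyticAt (f := f) (g := fun z ↦ q * z + c) (hf _) (by fun_prop)

/-- Jensen's formula: the average exceeds `log (‖q‖ r)` by a `log⁺` term. The bound is uniform in
`c`, so it can be summed over all poles. -/
lemma circleAverage_log_norm_affine_ge {q c : ℂ} (hq : q ≠ 0) {r : ℝ} (hr : 0 < r) :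
    log (‖q‖ * r) ≤ circleAverage (fun z ↦ log ‖q * z + c‖) 0 r := by
  have h : (fun z ↦ log ‖q * z + c‖) =ᶠ[codiscreteWithin (sphere 0 |r|)]
      fun z ↦ log ‖q‖ + log ‖z - -c / q‖ := by
    filter_upwards [codiscreteWithin_mono (Set.subset_univ _)
      (Set.finite_singleton (-c / q)).compl_mem_codiscrete] with z hz
    have h0 : z - -c / q ≠ 0 := sub_ne_zero.mpr hz
    rw [← log_mul (norm_ne_zero_iff.mpr hq) (norm_ne_zero_iff.mpr h0), ← norm_mul]
    congr 2
    field_simp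
    ring
  have hi : CircleIntegrable (fun z ↦ log ‖z - -c / q‖) 0 r :=
    (analyticOnNhd_id.sub analyticOnNhd_const).meromorphicOn.circleIntegrable_log_norm
  rw [circleAverage_congr_codiscreteWithin h hr.ne', circleAverage_fun_add
    (circleIntegrable_const _ _ _) hi,
    circleAverage_const, circleAverage_log_norm_sub_const_eq_log_radius_add_posLog hr.ne',
    log_mul (norm_ne_zero_iff.mpr hq) hr.ne']
  linarith [posLog_nonneg (x := r⁻¹ * ‖0 - -c / q‖)]

/-- The proximity function of `f (q z + c)` is bounded in terms of that of `f` and of the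
counting function of the poles of `f`. -/
theorem proximity_comp_affine_le {f : ℂ → ℂ} (hf : Meromorphic f)
    (hord : ∀ z, meromorphicOrderAt f z ≠ ⊤) {q c : ℂ} (hq0 : 0 < ‖q‖) (hq1 : ‖q‖ < 1) {r : ℝ}
    (hr1 : 1 ≤ r) (hrc : ‖c‖ ≤ r) :
    proximity (fun z ↦ f (q * z + c)) ⊤ r ≤
      3 * proximity f ⊤ (4 * r) + log (8 / ‖q‖) / log 2 * logCounting f ⊤ (8 * r) := by
  have hr0 : 0 < r := by linarith
  have hq : q ≠ 0 := norm_pos_iff.mp hq0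
  -- On `‖z‖ = r` one has `‖q z + c‖ ≤ 2 r = R / 2`, the range of the Poisson–Jensen inequality.
  set R := 4 * r with hR
  have hR0 : 0 < R := by positivity
  set D := divisor f (closedBall 0 R) with hD
  set S := (D.finiteSupport (isCompact_closedBall 0 R)).toFinset with hS
  have hSD : D.support ⊆ S := by rw [hS, Set.Finite.coe_toFinset]
  have hSR : ∀ u ∈ S, u ∈ closedBall (0 : ℂ) R := fun u hu ↦
    D.supportWithinDomain (by simpa [hS] using hu)
  have hmaps : Set.MapsTo (fun z ↦ q * z + c) (sphere 0 |r|)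
      (closedBall 0 R ∩ closedBall 0 (R / 2)) := by
    intro z hz
    rw [abs_of_pos hr0, mem_sphere_zero_iff_norm] at hz
    have : ‖q * z + c‖ ≤ 2 * r := by
      calc ‖q * z + c‖ ≤ ‖q‖ * ‖z‖ + ‖c‖ := by rw [← norm_mul]; exact norm_add_le _ _
        _ ≤ 1 * r + r := by rw [hz]; gcongr
        _ = 2 * r := by ring
    simp only [Set.mem_inter_iff, mem_closedBall_zero_iff]
    constructor <;> linarith
  have hPJ := eventually_comp_affine hq (fun z hz ↦ (hmaps hz).1)
    (eventually_log_norm_le (f := f) (fun z _ ↦ hf z) (fun z ↦ hord z) hR0 hSD)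
  have hDneg : ∀ u, (0 : ℝ) ≤ (D⁻ u : ℤ) := fun u ↦ by
    have : (0 : Function.locallyFinsuppWithin (closedBall (0 : ℂ) R) ℤ) ≤ D⁻ := negPart_nonneg D
    exact_mod_cast this u
  have hm0 : 0 ≤ proximity f ⊤ R := proximity_nonneg R
  have hle : ∀ᶠ z in codiscreteWithin (sphere 0 |r|), log⁺ ‖f (q * z + c)‖ ≤
      3 * proximity f ⊤ R +
        ∑ u ∈ S, (D⁻ u : ℝ) * (log (2 * R) - log ‖q * z + (c - u)‖) := by
    filter_upwards [hPJ, self_mem_codiscreteWithin _] with z hz hzs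
    have hw := mem_closedBall_zero_iff.mp (hmaps hzs).2
    have e : ∀ u, q * z + c - u = q * z + (c - u) := fun u ↦ by ring
    simp only [e] at hz
    -- Passing from `log` to `log⁺` needs a nonnegative right-hand side, which holds because `‖q z +
    -- c - u‖ ≤ 2 R`.
    rw [posLog_def]
    refine max_le (add_nonneg (by positivity) (Finset.sum_nonneg fun u hu ↦
      mul_nonneg (hDneg u) ?_)) (hz hw)
    have hu := mem_closedBall_zero_iff.mp (hSR u hu)
    have h1 : ‖q * z + (c - u)‖ ≤ 2 * R := by
      rw [← e]
      dsimp only at hw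
      linarith [norm_sub_le (q * z + c) u]
    rw [sub_nonneg]
    rcases eq_or_lt_of_le (norm_nonneg (q * z + (c - u))) with h | h
    · rw [← h, log_zero]; exact log_nonneg (by linarith)
    · exact log_le_log h h1
  have hi : ∀ a : ℂ, CircleIntegrable (fun z ↦ log ‖q * z + a‖) 0 r := fun a ↦
    MeromorphicOn.circleIntegrable_log_norm fun z _ ↦
      AnalyticAt.meromorphicAt (f := fun z ↦ q * z + a) (by fun_prop)
  have hi' : ∀ u ∈ S, CircleIntegrable
      (fun z ↦ (D⁻ u : ℝ) * (log (2 * R) - log ‖q * z + (c - u)‖)) 0 r := fun u _ ↦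
    ((circleIntegrable_const (log (2 * R)) 0 r).sub (hi (c - u))).const_smul
      (a := (D⁻ u : ℝ))
  have hi2 : CircleIntegrable (fun z ↦ ∑ u ∈ S, (D⁻ u : ℝ) *
      (log (2 * R) - log ‖q * z + (c - u)‖)) 0 r := by
    have := CircleIntegrable.sum S hi'
    convert this using 1
    ext z
    simp
  rw [proximity_top]
  refine (circleAverage_mono_codiscreteWithin hr0.ne'
    (MeromorphicOn.circleIntegrable_posLog_norm fun z _ ↦ meromorphic_comp_affine hf q c z)
    ((circleIntegrable_const _ _ _).add hi2) hle).trans ?_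
  rw [circleAverage_add (circleIntegrable_const _ _ _) hi2, circleAverage_const,
    circleAverage_fun_sum hi']
  refine add_le_add le_rfl ?_
  have hlog2 : 0 < log 2 := log_pos one_lt_two
  have hcount := sum_negPart_divisor_mul_log_two_le hf (by linarith) hSR
  have hlog8 : 0 ≤ log (8 / ‖q‖) :=
    log_nonneg ((one_le_div hq0).mpr (by linarith))
  calc ∑ u ∈ S, circleAverage
        (fun z ↦ (D⁻ u : ℝ) * (log (2 * R) - log ‖q * z + (c - u)‖)) 0 r
      ≤ ∑ u ∈ S, (D⁻ u : ℝ) * log (8 / ‖q‖) := by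
        refine Finset.sum_le_sum fun u _ ↦ ?_
        have h1 := circleAverage_log_norm_affine_ge (c := c - u) hq hr0
        simp only [← smul_eq_mul]
        rw [circleAverage_fun_smul, smul_eq_mul, smul_eq_mul]
        refine mul_le_mul_of_nonneg_left ?_ (hDneg u)
        simp only [smul_eq_mul]
        rw [circleAverage_fun_sub (circleIntegrable_const _ _ _) (hi (c - u)),
          circleAverage_const]
        have h2 : log (8 / ‖q‖) = log (2 * R) - log (‖q‖ * r) := by
          rw [← log_div (by positivity) (by positivity)]
          congr 1
          rw [hR]
          field_simp
          norm_num
        linarith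
    _ = log (8 / ‖q‖) / log 2 * ∑ u ∈ S, (D⁻ u : ℝ) * log 2 := by
        rw [Finset.mul_sum]
        refine Finset.sum_congr rfl fun u _ ↦ ?_
        field_simp
    _ ≤ log (8 / ‖q‖) / log 2 * logCounting f ⊤ (8 * r) := by
        have e : 8 * r = 2 * R := by rw [hR]; ring
        rw [e]
        gcongr

end Growth

/-! ### Zero-free entire functions of small growth -/

section ZeroFree

open Real Metric MeromorphicOn InnerProductSpace ValueDistribution

/-- An entire function whose real part is at most `C √r` on the disc of radius `r`, for all large
`r`, is constant. -/
lemma apply_eq_apply_of_re_le_sqrt {φ : ℂ → ℂ} (hφ : Differentiable ℂ φ) {C r₀ : ℝ}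
    (hC : ∀ r ≥ r₀, ∀ z : ℂ, ‖z‖ ≤ r → (φ z).re ≤ C * √r) (z w : ℂ) : φ z = φ w := by
  refine is_const_of_deriv_eq_zero hφ (fun a ↦ ?_) z w
  set K := max C 1 with hK
  have hK0 : 0 < K := lt_of_lt_of_le one_pos (le_max_right _ _)
  -- Cauchy's estimate on the circle of radius `s` about `a`, which lies in `‖x‖ ≤ 2 s`; there
  -- Borel–Carathéodory for the disc of radius `4 s` bounds `φ`. Taking `K ≥ 1` keeps its bound on
  -- the real part positive.
  have hbound : ∀ᶠ s in atTop, ‖deriv φ a‖ ≤ (4 * K * √(4 * s) + 3 * ‖φ 0‖) / s := by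
    filter_upwards [eventually_ge_atTop (max (max ‖a‖ r₀) 1)] with s hs
    have hs1 : 1 ≤ s := (le_max_right _ _).trans hs
    have hsa : ‖a‖ ≤ s := ((le_max_left _ _).trans (le_max_left _ _)).trans hs
    have hsr : r₀ ≤ s := ((le_max_right _ _).trans (le_max_left _ _)).trans hs
    have hs0 : 0 < s := by linarith
    have hM : 0 < K * √(4 * s) := by positivity
    refine Complex.norm_deriv_le_of_forall_mem_sphere_norm_le hs0 hφ.diffContOnCl fun x hx ↦ ?_
    have hx2 : ‖x‖ ≤ 2 * s := by
      have h1 : ‖x - a‖ = s := mem_sphere_iff_norm.mp hx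
      calc ‖x‖ = ‖(x - a) + a‖ := by simp
        _ ≤ ‖x - a‖ + ‖a‖ := norm_add_le _ _
        _ ≤ 2 * s := by linarith
    have hb := Complex.borelCaratheodory (R := 4 * s) (z := x) hM hφ.differentiableOn
      (fun y hy ↦ (hC (4 * s) (by linarith) y (mem_ball_zero_iff.mp hy).le).trans
        (by gcongr; exact le_max_left _ _)) (by positivity)
      (by rw [mem_ball_zero_iff]; linarith)
    refine hb.trans ?_
    have h2 : 0 < 4 * s - ‖x‖ := by linarith
    have h3 : 2 * (K * √(4 * s)) * ‖x‖ / (4 * s - ‖x‖) ≤ 4 * K * √(4 * s) := by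
      rw [div_le_iff₀ h2]
      nlinarith
    have h4 : ‖φ 0‖ * (4 * s + ‖x‖) / (4 * s - ‖x‖) ≤ 3 * ‖φ 0‖ := by
      rw [div_le_iff₀ h2]
      nlinarith [norm_nonneg (φ 0)]
    exact add_le_add h3 h4
  have hlim : Tendsto (fun s : ℝ ↦ (4 * K * √(4 * s) + 3 * ‖φ 0‖) / s) atTop (𝓝 0) := by
    have h1 : Tendsto (fun s : ℝ ↦ 8 * K * (√s)⁻¹ + 3 * ‖φ 0‖ * s⁻¹) atTop
        (𝓝 (8 * K * 0 + 3 * ‖φ 0‖ * 0)) :=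
      ((tendsto_inv_atTop_zero.comp tendsto_sqrt_atTop).const_mul _).add
        (tendsto_inv_atTop_zero.const_mul _)
    simp only [mul_zero, add_zero] at h1
    refine h1.congr' ?_
    filter_upwards [eventually_gt_atTop 0] with s hs
    have h2 : √(4 * s) = 2 * √s := by
      rw [sqrt_mul (by norm_num), show (4 : ℝ) = 2 ^ 2 by norm_num, sqrt_sq (by norm_num)]
    rw [h2]
    have h3 : √s * √s = s := mul_self_sqrt hs.le
    have h4 : √s ≠ 0 := (sqrt_pos.mpr hs).ne'
    have h5 : (√s)⁻¹ = √s / s := by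
      field_simp
      rw [sq, h3]
    rw [h5]
    field_simp
    ring
  exact norm_le_zero_iff.mp (ge_of_tendsto hlim hbound)

/-- A zero free entire function with proximity function `O(√r)` is constant. -/
theorem exists_eq_const_of_proximity_isBigO {F : ℂ → ℂ} (hF : Differentiable ℂ F)
    (hF0 : ∀ z, F z ≠ 0) (hO : proximity F ⊤ =O[atTop] fun r ↦ √r) : ∃ a, ∀ z, F z = a := by
  have han : ∀ z, AnalyticAt ℂ F z := fun z ↦ hF.analyticAt z
  obtain ⟨φ, hφ, hφF⟩ := HarmonicOnNhd.exists_analyticOnNhd_univ_re_eq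
    (f := fun z ↦ log ‖F z‖) fun z _ ↦ (han z).harmonicAt_log_norm (hF0 z)
  have hφ' : Differentiable ℂ φ := fun z ↦ (hφ z (Set.mem_univ z)).differentiableAt
  obtain ⟨C, hC⟩ := hO.bound
  obtain ⟨r₀, hr₀⟩ := eventually_atTop.mp hC
  have hconst : ∀ z w, φ z = φ w := by
    -- The factor `3` is Harnack's; `√2` comes from taking the Poisson integral over radius `2 r`.
    refine apply_eq_apply_of_re_le_sqrt hφ' (C := 3 * (C * √2)) (r₀ := max r₀ 1)
      fun r hr z hz ↦ ?_
    have hr1 : 1 ≤ r := (le_max_right _ _).trans hr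
    have hr0' : r₀ ≤ r := (le_max_left _ _).trans hr
    rw [show (φ z).re = log ‖F z‖ from congrFun hφF z]
    have hz2 : ‖z‖ ≤ 2 * r / 2 := by linarith
    rw [← poissonIntegral_log_norm_of_ne_zero (R := 2 * r) (fun w _ ↦ han w) (fun w _ ↦ hF0 w)
      (by rw [mem_ball_zero_iff]; linarith)]
    refine (poissonIntegral_log_norm_le_proximity (fun w _ ↦ (han w).meromorphicAt)
      (by positivity) hz2).trans ?_
    have h1 := hr₀ (2 * r) (by linarith)
    rw [norm_eq_abs, norm_eq_abs, abs_of_nonneg (sqrt_nonneg _), sqrt_mul (by norm_num)] at h1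
    have h2 := (le_abs_self _).trans h1
    linarith
  have hnorm : ∀ z, ‖F z‖ = exp (φ 0).re := fun z ↦ by
    rw [hconst 0 z, show (φ z).re = log ‖F z‖ from congrFun hφF z,
      exp_log (norm_pos_iff.mpr (hF0 z))]
  refine ⟨F 0, fun z ↦ hF.apply_eq_apply_of_bounded ?_ z 0⟩
  refine isBounded_iff_forall_norm_le.mpr ⟨exp (φ 0).re, ?_⟩
  rintro _ ⟨z, rfl⟩
  exact (hnorm z).le

end ZeroFree

/-! ### Rational functions -/

section Rational

lemma eventually_codiscrete_eval_ne_zero {P : ℂ[X]} (hP : P ≠ 0) :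
    ∀ᶠ z in codiscrete ℂ, P.eval z ≠ 0 := by
  filter_upwards [(P.roots.toFinset.finite_toSet).compl_mem_codiscrete] with z hz h
  exact hz (by simp [hP, h])

lemma IsRationalFun.congr {f g : ℂ → ℂ} (hf : IsRationalFun f) (h : g =ᶠ[codiscrete ℂ] f) :
    IsRationalFun g := by
  obtain ⟨P, Q, hQ, hf⟩ := hf
  exact ⟨P, Q, hQ, h.trans hf⟩

lemma isRationalFun_const (a : ℂ) : IsRationalFun fun _ ↦ a :=
  ⟨C a, 1, one_ne_zero, by simp⟩

lemma isRationalFun_id : IsRationalFun fun z ↦ z :=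
  ⟨X, 1, one_ne_zero, by simp⟩

lemma IsRationalFun.mul {f g : ℂ → ℂ} (hf : IsRationalFun f) (hg : IsRationalFun g) :
    IsRationalFun fun z ↦ f z * g z := by
  obtain ⟨P, Q, hQ, hf⟩ := hf
  obtain ⟨P', Q', hQ', hg⟩ := hg
  refine ⟨P * P', Q * Q', mul_ne_zero hQ hQ', ?_⟩
  filter_upwards [hf, hg] with z h1 h2
  rw [h1, h2, eval_mul, eval_mul, div_mul_div_comm]

lemma IsRationalFun.add {f g : ℂ → ℂ} (hf : IsRationalFun f) (hg : IsRationalFun g) :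
    IsRationalFun fun z ↦ f z + g z := by
  obtain ⟨P, Q, hQ, hf⟩ := hf
  obtain ⟨P', Q', hQ', hg⟩ := hg
  refine ⟨P * Q' + Q * P', Q * Q', mul_ne_zero hQ hQ', ?_⟩
  filter_upwards [hf, hg, eventually_codiscrete_eval_ne_zero hQ,
    eventually_codiscrete_eval_ne_zero hQ'] with z h1 h2 h3 h4
  rw [h1, h2, eval_add, eval_mul, eval_mul, eval_mul, div_add_div _ _ h3 h4]

lemma IsRationalFun.sub {f g : ℂ → ℂ} (hf : IsRationalFun f) (hg : IsRationalFun g) :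
    IsRationalFun fun z ↦ f z - g z := by
  refine (hf.add ((isRationalFun_const (-1)).mul hg)).congr (Eventually.of_forall fun z ↦ ?_)
  ring

lemma IsRationalFun.inv {f : ℂ → ℂ} (hf : IsRationalFun f) : IsRationalFun fun z ↦ (f z)⁻¹ := by
  obtain ⟨P, Q, hQ, hf⟩ := hf
  by_cases hP : P = 0
  · refine (isRationalFun_const 0).congr ?_
    filter_upwards [hf] with z h
    simp [h, hP]
  · refine ⟨Q, P, hP, ?_⟩
    filter_upwards [hf] with z h
    rw [h, inv_div]

lemma IsRationalFun.zpow {f : ℂ → ℂ} (hf : IsRationalFun f) (n : ℤ) :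
    IsRationalFun fun z ↦ f z ^ n := by
  have hnat : ∀ m : ℕ, IsRationalFun fun z ↦ f z ^ m := fun m ↦ by
    induction m with
    | zero => simpa using isRationalFun_const 1
    | succ m ih => simpa only [pow_succ] using ih.mul hf
  cases n with
  | ofNat m => simpa using hnat m
  | negSucc m => simpa only [zpow_negSucc] using (hnat (m + 1)).inv

lemma IsRationalFun.prod {ι : Type*} (s : Finset ι) {f : ι → ℂ → ℂ}
    (hf : ∀ i ∈ s, IsRationalFun (f i)) : IsRationalFun fun z ↦ ∏ i ∈ s, f i z := by
  classical
  induction s using Finset.induction_on with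
  | empty => simpa using isRationalFun_const 1
  | insert i s hi ih =>
    simp only [Finset.prod_insert hi]
    exact (hf i (Finset.mem_insert_self i s)).mul
      (ih fun j hj ↦ hf j (Finset.mem_insert_of_mem hj))

lemma IsRationalFun.eventually_eq_zero_or_ne_zero {f : ℂ → ℂ} (hf : IsRationalFun f) :
    (∀ᶠ z in codiscrete ℂ, f z = 0) ∨ ∀ᶠ z in codiscrete ℂ, f z ≠ 0 := by
  obtain ⟨P, Q, hQ, hf⟩ := hf
  by_cases hP : P = 0
  · left
    filter_upwards [hf] with z h
    simp [h, hP]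
  · right
    filter_upwards [hf, eventually_codiscrete_eval_ne_zero hQ,
      eventually_codiscrete_eval_ne_zero hP] with z h h1 h2
    rw [h]
    exact div_ne_zero h2 h1

end Rational

/-! ### Functions of small growth -/

section SmallGrowth

open Real Metric MeromorphicOn ValueDistribution

lemma isBigO_proximity_mul {f g : ℂ → ℂ} (hf : Meromorphic f) (hg : Meromorphic g)
    (hf' : proximity f ⊤ =O[atTop] fun r ↦ √r) (hg' : proximity g ⊤ =O[atTop] fun r ↦ √r) :
    proximity (f * g) ⊤ =O[atTop] fun r ↦ √r := by
  refine IsBigO.trans (IsBigO.of_norm_le fun r ↦ ?_) (hf'.add hg')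
  rw [norm_of_nonneg (proximity_nonneg r)]
  exact proximity_mul_top_le hf hg r

lemma meromorphic_sub_const_zpow (u : ℂ) (n : ℤ) : Meromorphic ((fun z ↦ z - u) ^ n) := fun z ↦
  MeromorphicAt.zpow (by fun_prop) n

/-- For nonnegative powers `log x ≤ 2 √x` suffices; for negative ones the proximity function
vanishes once `‖z - u‖ ≥ 1` on the circle. -/
lemma isBigO_proximity_sub_const_zpow (u : ℂ) (n : ℤ) :
    proximity ((fun z ↦ z - u) ^ n) ⊤ =O[atTop] fun r ↦ √r := by
  have hr : ∀ r : ℝ, ‖u‖ + 1 ≤ r → ∀ z ∈ sphere (0 : ℂ) |r|, 1 ≤ ‖z - u‖ ∧ ‖z - u‖ ≤ 2 * r := by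
    intro r hr z hz
    have hu := norm_nonneg u
    rw [abs_of_nonneg (by linarith), mem_sphere_zero_iff_norm] at hz
    have h1 := norm_sub_norm_le z u
    have h2 := norm_sub_le z u
    constructor <;> linarith
  cases n with
  | ofNat m =>
    refine IsBigO.of_bound (m * (2 * √2)) ?_
    filter_upwards [eventually_ge_atTop (‖u‖ + 1)] with r h
    have hr0 : 0 ≤ r := by linarith [norm_nonneg u]
    rw [Int.ofNat_eq_natCast, zpow_natCast, proximity_pow_top, norm_of_nonneg
      ((nsmul_nonneg proximity_nonneg m) r), norm_of_nonneg (sqrt_nonneg r), Pi.smul_apply,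
      nsmul_eq_mul, mul_assoc, proximity_top]
    refine mul_le_mul_of_nonneg_left ?_ (Nat.cast_nonneg m)
    refine circleAverage_mono_on_of_le_circle
      (MeromorphicOn.circleIntegrable_posLog_norm fun z _ ↦ by fun_prop) fun z hz ↦ ?_
    obtain ⟨h1, h2⟩ := hr r h z hz
    have h0 : 0 < ‖z - u‖ := by linarith
    rw [posLog_eq_log (by rwa [abs_norm])]
    have h3 := log_le_sub_one_of_pos (sqrt_pos.mpr h0)
    rw [log_sqrt h0.le] at h3
    have h4 : √‖z - u‖ ≤ √2 * √r := by
      rw [← sqrt_mul (by norm_num)]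
      exact sqrt_le_sqrt h2
    linarith
  | negSucc m =>
    refine IsBigO.of_bound 0 ?_
    filter_upwards [eventually_ge_atTop (‖u‖ + 1)] with r h
    rw [zero_mul, norm_le_zero_iff, proximity_top]
    refine circleAverage_const_on_circle fun z hz ↦ ?_
    have h1 := (hr r h z hz).1
    rw [posLog_eq_zero_iff, abs_norm, Pi.pow_apply, zpow_negSucc, norm_inv, norm_pow]
    exact inv_le_one_of_one_le₀ (one_le_pow₀ h1)

/-- A meromorphic function with finitely many zeros and poles and proximity function `O(√r)` is
rational. -/
theorem isRationalFun_of_finite_divisor {h : ℂ → ℂ} (hh : Meromorphic h)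
    (hord : ∀ z, meromorphicOrderAt h z ≠ ⊤) (hfin : (divisor h Set.univ).support.Finite)
    (hO : proximity h ⊤ =O[atTop] fun r ↦ √r) : IsRationalFun h := by
  obtain ⟨F, hF, hF0, hhF⟩ := MeromorphicOn.extract_zeros_poles (U := Set.univ)
    (fun z _ ↦ hh z) (fun z ↦ hord z) hfin
  set D := divisor h Set.univ with hD
  set S := hfin.toFinset with hS
  set Φ : ℂ → ℂ := ∏ u ∈ S, (fun z ↦ z - u) ^ D u with hΦ
  -- `Ψ` inverts `Φ` off the finite set `S`, so the zero-free factor is `F = Ψ * h` and inherits the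
  -- bound `O(√r)`.
  set Ψ : ℂ → ℂ := ∏ u ∈ S, (fun z ↦ z - u) ^ (-D u) with hΨ
  have hprod : (∏ᶠ u, (fun z : ℂ ↦ z - u) ^ D u) = Φ := by
    refine finprod_eq_prod_of_mulSupport_subset _ fun u hu ↦ ?_
    rw [hS, Set.Finite.coe_toFinset]
    intro h0
    exact hu (by simp [h0])
  rw [hprod] at hhF
  have hΨm : Meromorphic Ψ := by
    intro z
    exact MeromorphicAt.prod fun u _ ↦ meromorphic_sub_const_zpow u _ z
  have hΨO : proximity Ψ ⊤ =O[atTop] fun r ↦ √r := by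
    have key : ∀ T : Finset ℂ, Meromorphic (∏ u ∈ T, (fun z : ℂ ↦ z - u) ^ (-D u)) ∧
        proximity (∏ u ∈ T, (fun z : ℂ ↦ z - u) ^ (-D u)) ⊤ =O[atTop] fun r ↦ √r := by
      classical
      intro T
      induction T using Finset.induction_on with
      | empty =>
        refine ⟨fun z ↦ analyticAt_const.meromorphicAt, IsBigO.of_bound 0 ?_⟩
        filter_upwards with r
        simp [proximity_top, circleAverage_const]
      | insert u T hu ih =>
        rw [Finset.prod_insert hu]
        exact ⟨(meromorphic_sub_const_zpow u _).mul ih.1,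
          isBigO_proximity_mul (meromorphic_sub_const_zpow u _) ih.1
            (isBigO_proximity_sub_const_zpow u _) ih.2⟩
    exact (key S).2
  have hFeq : F =ᶠ[codiscrete ℂ] Ψ * h := by
    filter_upwards [hhF, S.finite_toSet.compl_mem_codiscrete] with z hz hzS
    have h1 : Ψ z * Φ z = 1 := by
      rw [hΨ, hΦ, Finset.prod_apply, Finset.prod_apply, ← Finset.prod_mul_distrib]
      refine Finset.prod_eq_one fun u hu ↦ ?_
      have : z - u ≠ 0 := sub_ne_zero.mpr fun h ↦ hzS (h ▸ hu)
      rw [Pi.pow_apply, Pi.pow_apply, ← zpow_add₀ this, neg_add_cancel, zpow_zero]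
    rw [Pi.mul_apply, hz, Pi.smul_apply', smul_eq_mul, ← mul_assoc, h1, one_mul]
  have hFO : proximity F ⊤ =O[atTop] fun r ↦ √r := by
    refine IsBigO.congr' (isBigO_proximity_mul hΨm hh hΨO hO) ?_ EventuallyEq.rfl
    filter_upwards [eventually_gt_atTop 0] with r hr
    exact (proximity_congr_codiscrete hFeq hr.ne').symm
  obtain ⟨a, ha⟩ := exists_eq_const_of_proximity_isBigO
    (fun z ↦ (hF z (Set.mem_univ z)).differentiableAt) (fun z ↦ hF0 ⟨z, Set.mem_univ z⟩) hFO
  refine ((IsRationalFun.prod S fun u _ ↦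
    (isRationalFun_id.sub (isRationalFun_const u)).zpow (D u)).mul
      (isRationalFun_const a)).congr ?_
  filter_upwards [hhF] with z hz
  rw [hz, Pi.smul_apply', smul_eq_mul, ha, hΦ, Finset.prod_apply]
  rfl

lemma isBigO_proximity_of_characteristic {f : ℂ → ℂ}
    (hf : characteristic f ⊤ =O[atTop] fun r ↦ √r) : proximity f ⊤ =O[atTop] fun r ↦ √r := by
  refine IsBigO.trans (IsBigO.of_bound 1 ?_) hf
  filter_upwards [eventually_ge_atTop 1] with r hr
  rw [one_mul, norm_of_nonneg (proximity_nonneg r), norm_of_nonneg (characteristic_nonneg hr),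
    characteristic, Pi.add_apply]
  exact le_add_of_nonneg_right (logCounting_nonneg hr)

lemma isBigO_logCounting_of_characteristic {f : ℂ → ℂ}
    (hf : characteristic f ⊤ =O[atTop] fun r ↦ √r) : logCounting f ⊤ =O[atTop] fun r ↦ √r := by
  refine IsBigO.trans (IsBigO.of_bound 1 ?_) hf
  filter_upwards [eventually_ge_atTop 1] with r hr
  rw [one_mul, norm_of_nonneg (logCounting_nonneg hr), norm_of_nonneg (characteristic_nonneg hr),
    characteristic, Pi.add_apply]
  exact le_add_of_nonneg_left (proximity_nonneg r)

lemma isBigO_sqrt_comp_const_mul {φ : ℝ → ℝ} (hφ : φ =O[atTop] fun r ↦ √r) {a : ℝ} (ha : 0 < a) :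
    (fun r ↦ φ (a * r)) =O[atTop] fun r ↦ √r := by
  refine (hφ.comp_tendsto (tendsto_id.const_mul_atTop ha)).trans
    (IsBigO.of_bound (√a) (Eventually.of_forall fun r ↦ ?_))
  simp [sqrt_mul ha.le, abs_of_nonneg (sqrt_nonneg _)]

lemma isBigO_one_sqrt : (1 : ℝ → ℝ) =O[atTop] fun r ↦ √r := by
  refine IsBigO.of_bound 1 ?_
  filter_upwards [eventually_ge_atTop 1] with r hr
  rw [Pi.one_apply, norm_one, one_mul, norm_of_nonneg (sqrt_nonneg r)]
  exact one_le_sqrt.mpr hr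

lemma isBigO_characteristic_inv {f : ℂ → ℂ} (hf : Meromorphic f)
    (hO : characteristic f ⊤ =O[atTop] fun r ↦ √r) :
    characteristic f⁻¹ ⊤ =O[atTop] fun r ↦ √r := by
  have := hO.sub ((isBigO_characteristic_sub_characteristic_inv hf).trans isBigO_one_sqrt)
  simpa using this

lemma isBigO_characteristic_sub_const {f : ℂ → ℂ} (hf : Meromorphic f) (a : ℂ)
    (hO : characteristic f ⊤ =O[atTop] fun r ↦ √r) :
    characteristic (fun z ↦ f z - a) ⊤ =O[atTop] fun r ↦ √r := by
  have := hO.sub ((isBigO_characteristic_sub_characteristic_shift (a₀ := a) hf).trans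
    isBigO_one_sqrt)
  simpa using this

lemma isBigO_characteristic_mul {f g : ℂ → ℂ} (hf : Meromorphic f) (hg : Meromorphic g)
    (hf0 : ∀ z, meromorphicOrderAt f z ≠ ⊤) (hg0 : ∀ z, meromorphicOrderAt g z ≠ ⊤)
    (hf' : characteristic f ⊤ =O[atTop] fun r ↦ √r)
    (hg' : characteristic g ⊤ =O[atTop] fun r ↦ √r) :
    characteristic (f * g) ⊤ =O[atTop] fun r ↦ √r := by
  refine IsBigO.trans (IsBigO.of_bound 1 ?_) (hf'.add hg')
  filter_upwards [eventually_ge_atTop 1] with r hr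
  rw [one_mul, norm_of_nonneg (characteristic_nonneg hr), norm_of_nonneg
    (add_nonneg (characteristic_nonneg hr) (characteristic_nonneg hr))]
  exact characteristic_mul_top_le hr hf hf0 hg hg0

lemma isBigO_characteristic_of_growthOrder {g : ℂ → ℂ} (hg : growthOrder g = 0) :
    characteristic g ⊤ =O[atTop] fun r ↦ √r := by
  have h1 : growthOrder g < ((1 / 2 : ℝ) : EReal) := by
    rw [hg]
    exact_mod_cast one_half_pos
  have h2 := eventually_lt_of_limsup_lt h1
  refine IsBigO.of_bound 1 ?_
  filter_upwards [h2, eventually_gt_atTop 1] with r hr hr1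
  rw [one_mul, norm_of_nonneg (characteristic_nonneg hr1.le), norm_of_nonneg (sqrt_nonneg r)]
  have hlog : 0 < log r := log_pos hr1
  rw [EReal.coe_lt_coe_iff, div_lt_iff₀ hlog] at hr
  have hs : 1 ≤ √r := one_le_sqrt.mpr hr1.le
  rcases le_or_gt (characteristic g ⊤ r) 1 with h | h
  · exact h.trans hs
  · rw [posLog_eq_log (by rw [abs_of_pos (by linarith)]; exact h.le)] at hr
    rw [← log_le_log_iff (by linarith) (by linarith), log_sqrt (by linarith)]
    linarith

end SmallGrowth

/-! ### The functional equation -/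

section FunctionalEquation

open Real Metric MeromorphicOn ValueDistribution

variable {q c : ℂ}

lemma meromorphicOrderAt_comp_affine (f : ℂ → ℂ) (hq : q ≠ 0) (z : ℂ) :
    meromorphicOrderAt (fun w ↦ f (q * w + c)) z = meromorphicOrderAt f (q * z + c) := by
  have h : HasDerivAt (fun w ↦ q * w + c) q z := by
    simpa using ((hasDerivAt_id z).const_mul q).add_const c
  exact meromorphicOrderAt_comp_of_deriv_ne_zero (f := f) (g := fun w ↦ q * w + c)
    (by fun_prop) (by rwa [h.deriv])

lemma eventually_codiscrete_comp_affine (hq : q ≠ 0) {p : ℂ → Prop}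
    (hp : ∀ᶠ z in codiscrete ℂ, p z) : ∀ᶠ z in codiscrete ℂ, p (q * z + c) :=
  eventually_comp_affine hq (Set.mapsTo_univ _ _) hp

/-- If the divisor of a function of small growth is invariant under `z ↦ q z + c` up to finitely
many points, then `f (q z + c) = ρ z * f z` with a rational function `ρ`. -/
theorem exists_isRationalFun_comp_affine_eq_mul (hq0 : 0 < ‖q‖) (hq1 : ‖q‖ < 1) {f : ℂ → ℂ}
    (hf : Meromorphic f) (hord : ∀ z, meromorphicOrderAt f z ≠ ⊤)
    (hO : characteristic f ⊤ =O[atTop] fun r ↦ √r)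
    (hfin : {z | (meromorphicOrderAt f (q * z + c)).untop₀ ≠
      (meromorphicOrderAt f z).untop₀}.Finite) :
    ∃ ρ, IsRationalFun ρ ∧ ∀ᶠ z in codiscrete ℂ, f (q * z + c) = ρ z * f z := by
  have hq : q ≠ 0 := norm_pos_iff.mp hq0
  set fσ : ℂ → ℂ := fun z ↦ f (q * z + c) with hfσ
  have hfσm : Meromorphic fσ := meromorphic_comp_affine hf q c
  have hh : ∀ z, meromorphicOrderAt (fσ * f⁻¹) z =
      meromorphicOrderAt f (q * z + c) + -meromorphicOrderAt f z := fun z ↦ by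
    rw [meromorphicOrderAt_mul (hfσm z) (hf z).inv, meromorphicOrderAt_inv,
      meromorphicOrderAt_comp_affine f hq]
  have hlift : ∀ z, ∃ n : ℤ, meromorphicOrderAt f z = n := fun z ↦
    ⟨_, (WithTop.coe_untop₀_of_ne_top (hord z)).symm⟩
  refine ⟨fσ * f⁻¹, isRationalFun_of_finite_divisor (hfσm.mul hf.inv) (fun z ↦ ?_) ?_ ?_, ?_⟩
  · obtain ⟨n, hn⟩ := hlift z
    obtain ⟨m, hm⟩ := hlift (q * z + c)
    rw [hh, hn, hm]
    exact WithTop.coe_ne_top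
  · refine hfin.subset fun z hz h ↦ hz ?_
    rw [divisor_apply (fun w _ ↦ (hfσm.mul hf.inv) w) (Set.mem_univ z), hh]
    obtain ⟨n, hn⟩ := hlift z
    obtain ⟨m, hm⟩ := hlift (q * z + c)
    rw [hn, hm, WithTop.untop₀_coe, WithTop.untop₀_coe] at h
    rw [hn, hm, h]
    change ((n + -n : ℤ) : WithTop ℤ).untop₀ = 0
    simp
  · refine isBigO_proximity_mul hfσm hf.inv ?_
      (isBigO_proximity_of_characteristic (isBigO_characteristic_inv hf hO))
    have h1 := isBigO_sqrt_comp_const_mul (isBigO_proximity_of_characteristic hO)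
      (show (0 : ℝ) < 4 by norm_num)
    have h2 := isBigO_sqrt_comp_const_mul (isBigO_logCounting_of_characteristic hO)
      (show (0 : ℝ) < 8 by norm_num)
    refine IsBigO.trans (IsBigO.of_bound 1 ?_)
      ((h1.const_mul_left 3).add (h2.const_mul_left (log (8 / ‖q‖) / log 2)))
    filter_upwards [eventually_ge_atTop 1, eventually_ge_atTop ‖c‖] with r hr1 hrc
    rw [one_mul, norm_of_nonneg (proximity_nonneg r)]
    exact (proximity_comp_affine_le hf hord hq0 hq1 hr1 hrc).trans (le_abs_self _)
  · filter_upwards [MeromorphicOn.eventually_codiscreteWithin_apply_ne_zero (U := Set.univ)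
      (fun z _ ↦ hf z) fun z _ ↦ hord z] with z hz
    simp [hfσ, hz]

/-- The multiplicities of the zeros of a meromorphic function are locally finite. -/
lemma finite_setOf_zeroMult_ne_zero {f : ℂ → ℂ} (hf : Meromorphic f) (r : ℝ) :
    {z | zeroMult f z ≠ 0 ∧ ‖z‖ ≤ r}.Finite := by
  refine ((divisor f (closedBall 0 r)).finiteSupport (isCompact_closedBall 0 r)).subset ?_
  rintro z ⟨h1, h2⟩ h3
  rw [divisor_apply (fun w _ ↦ hf w) (mem_closedBall_zero_iff.mpr h2)] at h3
  exact h1 (by rw [zeroMult, h3]; rfl)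

/-- A meromorphic function invariant under the contraction `z ↦ q z + c` is constant. -/
lemma exists_eq_const_of_comp_affine_eq (hq0 : 0 < ‖q‖) (hq1 : ‖q‖ < 1) {f : ℂ → ℂ}
    (hf : Meromorphic f) (hinv : ∀ᶠ z in codiscrete ℂ, f (q * z + c) = f z) :
    ∃ a, ∀ᶠ z in codiscrete ℂ, f z = a := by
  have hq : q ≠ 0 := norm_pos_iff.mp hq0
  have hq1' : q ≠ 1 := by rintro rfl; simp at hq1
  obtain ⟨p, hp⟩ : ∃ p, q * p + c = p :=
    ⟨c / (1 - q), by field_simp [sub_ne_zero.mpr hq1'.symm]; ring⟩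
  -- With `x ≠ p` the orbit of `x` is infinite and bounded, and invariance makes each of its points
  -- a zero of `f - f x` of the same order; so `f - f x` vanishes identically.
  obtain ⟨x, hx, hxp⟩ : ∃ x, AnalyticAt ℂ f x ∧ x ≠ p := by
    have h1 : ∀ᶠ x in 𝓝[≠] p, AnalyticAt ℂ f x := (hf p).eventually_analyticAt
    exact (h1.and self_mem_nhdsWithin).exists
  refine ⟨f x, ?_⟩
  set F : ℂ → ℂ := fun z ↦ f z - f x with hF
  have hFm : Meromorphic F := hf.sub fun z ↦ analyticAt_const.meromorphicAt
  by_cases htop : ∀ z, meromorphicOrderAt F z ≠ ⊤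
  swap
  · have h1 : ∀ z, meromorphicOrderAt F z = ⊤ := by
      by_contra! h
      exact htop (hFm.exists_meromorphicOrderAt_ne_top_iff_forall.mp h)
    rw [eventually_iff, mem_codiscrete]
    intro z
    rw [disjoint_principal_right, compl_compl]
    filter_upwards [meromorphicOrderAt_eq_top_iff.mp (h1 z)] with w hw
    exact sub_eq_zero.mp hw
  exfalso
  set σ : ℂ → ℂ := fun z ↦ q * z + c with hσ
  have hFσ : ∀ z, meromorphicOrderAt F (σ z) = meromorphicOrderAt F z := fun z ↦ by
    rw [hσ, ← meromorphicOrderAt_comp_affine F hq]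
    refine meromorphicOrderAt_congr ?_
    have h1 := (mem_codiscrete.mp hinv) z
    rw [disjoint_principal_right, compl_compl] at h1
    filter_upwards [h1] with w hw
    rw [hF]
    exact congrArg (· - f x) hw
  have hk : ∀ k, meromorphicOrderAt F (σ^[k] x) = meromorphicOrderAt F x := fun k ↦ by
    induction k with
    | zero => rfl
    | succ k ih => rw [Function.iterate_succ_apply', hFσ, ih]
  have hnorm : ∀ k, ‖σ^[k] x - p‖ = ‖q‖ ^ k * ‖x - p‖ := fun k ↦ by
    induction k with
    | zero => simp
    | succ k ih =>
      rw [Function.iterate_succ_apply', pow_succ', mul_assoc, ← ih, ← norm_mul]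
      congr 1
      simp only [hσ]
      linear_combination hp
  have hpos : 0 < meromorphicOrderAt F x := by
    have h1 : AnalyticAt ℂ F x := hx.sub analyticAt_const
    refine (tendsto_zero_iff_meromorphicOrderAt_pos (hFm x)).mp ?_
    have h2 : F x = 0 := sub_self _
    exact h2 ▸ h1.continuousAt.tendsto.mono_left nhdsWithin_le_nhds
  have hmult : zeroMult F x ≠ 0 := by
    obtain ⟨n, hn⟩ : ∃ n : ℤ, meromorphicOrderAt F x = n :=
      ⟨_, (WithTop.coe_untop₀_of_ne_top (htop x)).symm⟩
    rw [hn] at hpos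
    have hn0 : 0 < n := by exact_mod_cast hpos
    rw [zeroMult, hn, WithTop.untop₀_coe]
    omega
  have hinj : Function.Injective fun k ↦ σ^[k] x := by
    refine Function.Injective.of_comp (f := fun z ↦ ‖z - p‖) (StrictAnti.injective
      (strictAnti_nat_of_succ_lt fun k ↦ ?_))
    have h0 : 0 < ‖x - p‖ := norm_pos_iff.mpr (sub_ne_zero.mpr hxp)
    simp only [Function.comp_apply, hnorm]
    have h1 : ‖q‖ ^ (k + 1) < ‖q‖ ^ k := pow_lt_pow_right_of_lt_one₀ hq0 hq1 (Nat.lt_succ_self k)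
    gcongr
  refine (Set.infinite_range_of_injective hinj)
    ((finite_setOf_zeroMult_ne_zero hFm (‖x - p‖ + ‖p‖)).subset ?_)
  rintro _ ⟨k, rfl⟩
  refine ⟨by rwa [zeroMult, hk], ?_⟩
  calc ‖σ^[k] x‖ = ‖(σ^[k] x - p) + p‖ := by simp
    _ ≤ ‖σ^[k] x - p‖ + ‖p‖ := norm_add_le _ _
    _ ≤ ‖x - p‖ + ‖p‖ := by
      rw [hnorm]
      gcongr
      exact mul_le_of_le_one_left (norm_nonneg _) (pow_le_one₀ hq0.le hq1.le)

/-- A meromorphic function `f` such that `f` and a further affine function of `f` both satisfy a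
first order homogeneous equation with rational coefficients is rational. -/
theorem isRationalFun_of_comp_affine_eq_mul (hq0 : 0 < ‖q‖) (hq1 : ‖q‖ < 1) {f f₂ : ℂ → ℂ}
    (hf : Meromorphic f) {u v : ℂ} (hu : u ≠ 0) (hv : v ≠ 0)
    (hf₂ : ∀ᶠ z in codiscrete ℂ, f₂ z = u * f z + v) {ρ₁ ρ₂ : ℂ → ℂ} (hρ₁ : IsRationalFun ρ₁)
    (hρ₂ : IsRationalFun ρ₂) (h₁ : ∀ᶠ z in codiscrete ℂ, f (q * z + c) = ρ₁ z * f z)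
    (h₂ : ∀ᶠ z in codiscrete ℂ, f₂ (q * z + c) = ρ₂ z * f₂ z) : IsRationalFun f := by
  have hq : q ≠ 0 := norm_pos_iff.mp hq0
  have key : ∀ᶠ z in codiscrete ℂ, u * (ρ₁ z - ρ₂ z) * f z = v * (ρ₂ z - 1) := by
    filter_upwards [hf₂, eventually_codiscrete_comp_affine (c := c) hq hf₂, h₁, h₂]
      with z e1 e2 e3 e4
    rw [e1, e2, e3] at e4
    linear_combination e4
  -- If `ρ₁ = ρ₂`, then `v ≠ 0` forces both to be `1`; otherwise `key` can be solved for `f`.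
  rcases (hρ₁.sub hρ₂).eventually_eq_zero_or_ne_zero with h0 | h0
  · obtain ⟨a, ha⟩ := exists_eq_const_of_comp_affine_eq (c := c) hq0 hq1 hf (by
      filter_upwards [key, h0, h₁] with z e1 e2 e3
      rw [e2, mul_zero, zero_mul] at e1
      have e4 : ρ₂ z = 1 := by
        have := (mul_eq_zero.mp e1.symm).resolve_left hv
        linear_combination this
      have e5 : ρ₁ z = 1 := by linear_combination e2 + e4
      rw [e3, e5, one_mul])
    exact (isRationalFun_const a).congr ha
  · refine (((isRationalFun_const v).mul (hρ₂.sub (isRationalFun_const 1))).mul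
      ((isRationalFun_const u).mul (hρ₁.sub hρ₂)).inv).congr ?_
    filter_upwards [key, h0] with z e1 e2
    rw [← e1]
    field_simp

end FunctionalEquation

/-! ### Hahn-Picard values -/

section Values

variable {q c : ℂ} {g : ℂ → ℂ}

/-- The function whose zeros are the points at which `g` takes the value `a`. -/
noncomputable def valueFun (g : ℂ → ℂ) : WithTop ℂ → ℂ → ℂ
  | (a : ℂ) => fun w ↦ g w - a
  | ⊤ => fun w ↦ 1 / g w

lemma valueMult_eq_zeroMult (g : ℂ → ℂ) (a : WithTop ℂ) (z : ℂ) :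
    valueMult g a z = zeroMult (valueFun g a) z := by
  cases a <;> rfl

/-- The Hahn difference annihilates constants, so finite values and `∞` can be treated alike through
`valueFun`. -/
lemma hahnMult_eq_zeroMult (q c : ℂ) (g : ℂ → ℂ) (a : WithTop ℂ) (z : ℂ) :
    hahnMult q c g a z = zeroMult (hahnDiff q c (valueFun g a)) z := by
  cases a with
  | top => rfl
  | coe a =>
    have h : hahnDiff q c (valueFun g a) = hahnDiff q c g := by
      ext w
      simp [hahnDiff, valueFun]
    rw [h]
    rfl

lemma meromorphic_valueFun (hg : Meromorphic g) (a : WithTop ℂ) : Meromorphic (valueFun g a) := by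
  intro z
  cases a with
  | top => exact (MeromorphicAt.const 1 z).div (hg z)
  | coe a => exact (hg z).sub (MeromorphicAt.const a z)

lemma finite_setOf_valueMult_ne_zero (hg : Meromorphic g) (a : WithTop ℂ) (r : ℝ) :
    {z | valueMult g a z ≠ 0 ∧ ‖z‖ ≤ r}.Finite := by
  simp only [valueMult_eq_zeroMult]
  exact finite_setOf_zeroMult_ne_zero (meromorphic_valueFun hg a) r

lemma hahnCounting_eq_sum {a : WithTop ℂ} {r : ℝ} {S : Finset ℂ}
    (hS : ∀ z ∈ S, z ∈ Metric.ball (0 : ℂ) r)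
    (hS' : ∀ z ∈ Metric.ball (0 : ℂ) r, valueMult g a z ≠ 0 → z ∈ S) :
    hahnCounting q c g a r =
      ∑ z ∈ S, (valueMult g a z - min (valueMult g a z) (hahnMult q c g a z)) := by
  refine finsum_mem_eq_sum_of_inter_support_eq _ (Set.ext fun z ↦ ⟨fun h ↦ ⟨hS' z h.1 ?_, h.2⟩,
    fun h ↦ ⟨hS z h.1, h.2⟩⟩)
  intro h0
  exact h.2 (by simp [h0])

lemma isHahnPicardValue_of_finite {a : WithTop ℂ}
    (h : {z | 0 < valueMult g a z}.Finite) : IsHahnPicardValue q c g a := by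
  refine IsBigO.of_bound (∑ z ∈ h.toFinset, valueMult g a z : ℕ)
    (Eventually.of_forall fun r ↦ ?_)
  rw [norm_one, mul_one, Real.norm_natCast]
  classical
  rw [hahnCounting_eq_sum (S := h.toFinset.filter (· ∈ Metric.ball (0 : ℂ) r))
    (fun z hz ↦ (Finset.mem_filter.mp hz).2)
    fun z hz h0 ↦ Finset.mem_filter.mpr ⟨by simpa [Nat.pos_iff_ne_zero] using h0, hz⟩]
  exact_mod_cast (Finset.sum_le_sum fun z _ ↦ Nat.sub_le _ _).trans
    (Finset.sum_le_sum_of_subset (Finset.filter_subset _ _))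

/-- Each such point contributes at least `1` to the counting function, so more than `C` of them in
one disc would break the bound. -/
lemma IsHahnPicardValue.finite_setOf_lt (hg : Meromorphic g) {a : WithTop ℂ}
    (h : IsHahnPicardValue q c g a) : {z | hahnMult q c g a z < valueMult g a z}.Finite := by
  obtain ⟨C, hC⟩ := h.bound
  by_contra hinf
  obtain ⟨T, hT, hTcard⟩ := Set.Infinite.exists_subset_card_eq hinf (⌊C⌋₊ + 1)
  obtain ⟨ρ, hρ⟩ := (T.finite_toSet.image fun z ↦ ‖z‖).bddAbove
  obtain ⟨r, hr, hrρ⟩ := (hC.and (eventually_gt_atTop ρ)).exists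
  rw [norm_one, mul_one, Real.norm_natCast] at hr
  have hfin : {z | valueMult g a z ≠ 0 ∧ z ∈ Metric.ball (0 : ℂ) r}.Finite :=
    (finite_setOf_valueMult_ne_zero hg a r).subset fun z hz ↦
      ⟨hz.1, (mem_ball_zero_iff.mp hz.2).le⟩
  have hsum := hahnCounting_eq_sum (q := q) (c := c) (g := g) (a := a) (r := r)
    (S := hfin.toFinset) (fun z hz ↦ ((Set.Finite.mem_toFinset hfin).mp hz).2)
    fun z hz h0 ↦ (Set.Finite.mem_toFinset hfin).mpr ⟨h0, hz⟩
  have hTS : T ⊆ hfin.toFinset := fun z hz ↦ by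
    have h1 : hahnMult q c g a z < valueMult g a z := hT hz
    refine (Set.Finite.mem_toFinset hfin).mpr ⟨by omega, ?_⟩
    rw [mem_ball_zero_iff]
    exact (hρ ⟨z, hz, rfl⟩).trans_lt hrρ
  have hle : T.card ≤ hahnCounting q c g a r := by
    rw [hsum, Finset.card_eq_sum_ones]
    refine (Finset.sum_le_sum fun z hz ↦ ?_).trans (Finset.sum_le_sum_of_subset hTS)
    have h1 : hahnMult q c g a z < valueMult g a z := hT hz
    omega
  rw [hTcard] at hle
  have h1 := Nat.lt_floor_add_one C
  have h2 : ((⌊C⌋₊ + 1 : ℕ) : ℝ) ≤ hahnCounting q c g a r := by exact_mod_cast hle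
  push_cast at h2
  linarith

lemma zeroMult_eq_coe {f : ℂ → ℂ} {z : ℂ} (h : meromorphicOrderAt f z ≠ ⊤) :
    ∃ n : ℤ, meromorphicOrderAt f z = n ∧ zeroMult f z = n.toNat := by
  refine ⟨(meromorphicOrderAt f z).untop₀, (WithTop.coe_untop₀_of_ne_top h).symm, rfl⟩

/-- A zero of `f` whose multiplicity is at most that of the Hahn difference is mapped by
`z ↦ q z + c` to a zero of at least the same multiplicity. -/
lemma zeroMult_le_zeroMult_comp_affine (hq : q ≠ 0) (hq1 : q ≠ 1) {f : ℂ → ℂ} (hf : Meromorphic f)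
    (hord : ∀ z, meromorphicOrderAt f z ≠ ⊤) {z : ℂ}
    (h : zeroMult f z ≤ zeroMult (hahnDiff q c f) z) :
    zeroMult f z ≤ zeroMult f (q * z + c) := by
  by_cases h0 : zeroMult f z = 0
  · rw [h0]; exact Nat.zero_le _
  obtain ⟨n, hn, hn'⟩ := zeroMult_eq_coe (hord z)
  obtain ⟨m, hm, hm'⟩ := zeroMult_eq_coe (hord (q * z + c))
  have hn0 : 0 < n := by omega
  set L : ℂ → ℂ := fun w ↦ (q - 1) * w + c with hL
  have hLan : AnalyticAt ℂ L z := by fun_prop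
  have hLne : ∀ᶠ w in 𝓝[≠] z, L w ≠ 0 := by
    have h1 : ∀ᶠ w in codiscrete ℂ, w ≠ -c / (q - 1) :=
      (Set.finite_singleton (-c / (q - 1))).compl_mem_codiscrete
    have h2 := (mem_codiscrete.mp h1) z
    rw [disjoint_principal_right, compl_compl] at h2
    filter_upwards [h2] with w hw h3
    refine hw ?_
    rw [eq_div_iff (sub_ne_zero.mpr hq1)]
    linear_combination h3
  set fσ : ℂ → ℂ := fun w ↦ f (q * w + c) with hfσ
  have hfσm : MeromorphicAt fσ z := meromorphic_comp_affine hf q c z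
  have hdm : MeromorphicAt (hahnDiff q c f) z := (hfσm.sub (hf z)).div hLan.meromorphicAt
  -- Multiplying the Hahn difference by its denominator `L` can only raise the order at `z`, as `L`
  -- is analytic.
  have heq : fσ =ᶠ[𝓝[≠] z] hahnDiff q c f * L + f := by
    filter_upwards [hLne] with w hw
    simp only [hfσ, Pi.add_apply, Pi.mul_apply, hahnDiff]
    rw [div_mul_cancel₀ _ hw]
    ring
  have hd : (n : WithTop ℤ) ≤ meromorphicOrderAt (hahnDiff q c f) z := by
    by_cases ht : meromorphicOrderAt (hahnDiff q c f) z = ⊤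
    · rw [ht]; exact le_top
    · obtain ⟨k, hk, hk'⟩ := zeroMult_eq_coe ht
      rw [hk]
      exact_mod_cast (by omega : n ≤ k)
  have hσ : (n : WithTop ℤ) ≤ meromorphicOrderAt fσ z := by
    rw [meromorphicOrderAt_congr heq]
    refine le_trans (le_min ?_ hn.ge)
      (meromorphicOrderAt_add (hdm.mul hLan.meromorphicAt) (hf z))
    rw [meromorphicOrderAt_mul hdm hLan.meromorphicAt]
    exact le_add_of_le_of_nonneg hd hLan.meromorphicOrderAt_nonneg
  rw [hfσ, meromorphicOrderAt_comp_affine f hq, hm] at hσ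
  have hnm : n ≤ m := by exact_mod_cast hσ
  rw [hn', hm']
  exact Int.toNat_le_toNat hnm

lemma meromorphicOrderAt_sub_const_ne_top (hg : Meromorphic g) (hgt : ¬ IsRationalFun g)
    (a z : ℂ) : meromorphicOrderAt (fun w ↦ g w - a) z ≠ ⊤ := by
  have hm : Meromorphic fun w ↦ g w - a := meromorphic_valueFun hg a
  refine hm.exists_meromorphicOrderAt_ne_top_iff_forall.mp ?_ z
  by_contra! h
  refine hgt ((isRationalFun_const a).congr ?_)
  rw [EventuallyEq, eventually_iff, mem_codiscrete]
  intro w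
  rw [disjoint_principal_right, compl_compl]
  filter_upwards [meromorphicOrderAt_eq_top_iff.mp (h w)] with x hx
  exact sub_eq_zero.mp hx

lemma meromorphicOrderAt_one_div (g : ℂ → ℂ) (z : ℂ) :
    meromorphicOrderAt (fun w ↦ 1 / g w) z = -meromorphicOrderAt g z := by
  rw [← meromorphicOrderAt_inv]
  congr 1
  ext w
  simp

lemma meromorphicOrderAt_ne_top (hg : Meromorphic g) (hgt : ¬ IsRationalFun g) (z : ℂ) :
    meromorphicOrderAt g z ≠ ⊤ := by
  simpa using meromorphicOrderAt_sub_const_ne_top hg hgt 0 z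

lemma meromorphicOrderAt_valueFun_ne_top (hg : Meromorphic g) (hgt : ¬ IsRationalFun g)
    (a : WithTop ℂ) (z : ℂ) : meromorphicOrderAt (valueFun g a) z ≠ ⊤ := by
  cases a with
  | coe a => exact meromorphicOrderAt_sub_const_ne_top hg hgt a z
  | top =>
    change meromorphicOrderAt (fun w ↦ 1 / g w) z ≠ ⊤
    obtain ⟨n, hn, -⟩ := zeroMult_eq_coe (meromorphicOrderAt_ne_top hg hgt z)
    rw [meromorphicOrderAt_one_div g, hn]
    exact WithTop.coe_ne_top

/-- The points at which `g` takes a Hahn-Picard value, counted with multiplicity, are invariant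
under `z ↦ q z + c` up to finitely many points. -/
theorem IsHahnPicardValue.finite_setOf_valueMult_ne (hq0 : 0 < ‖q‖) (hq1 : ‖q‖ < 1)
    (hg : Meromorphic g) (hgt : ¬ IsRationalFun g) {a : WithTop ℂ}
    (h : IsHahnPicardValue q c g a) :
    {z | valueMult g a (q * z + c) ≠ valueMult g a z}.Finite := by
  refine finite_setOf_comp_affine_ne hq0 hq1 (finite_setOf_valueMult_ne_zero hg a)
    ((h.finite_setOf_lt hg).subset fun z hz ↦ ?_)
  by_contra hle
  rw [Set.mem_ofPred_eq, not_lt, valueMult_eq_zeroMult, hahnMult_eq_zeroMult] at hle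
  rw [Set.mem_ofPred_eq, valueMult_eq_zeroMult, valueMult_eq_zeroMult] at hz
  refine absurd (zeroMult_le_zeroMult_comp_affine (norm_pos_iff.mp hq0) ?_
    (meromorphic_valueFun hg a) (meromorphicOrderAt_valueFun_ne_top hg hgt a) hle) (not_le.mpr hz)
  rintro rfl
  simp at hq1

/-- Subtracting a constant does not change the poles, so the pole part of the divisor of `g - a` is
independent of `a`. -/
lemma untop₀_meromorphicOrderAt_sub_const (hg : Meromorphic g) (hgt : ¬ IsRationalFun g)
    (a z : ℂ) : (meromorphicOrderAt (fun w ↦ g w - a) z).untop₀ =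
      (valueMult g a z : ℤ) - valueMult g ⊤ z := by
  obtain ⟨n, hn, hn'⟩ := zeroMult_eq_coe (meromorphicOrderAt_ne_top hg hgt z)
  obtain ⟨m, hm, hm'⟩ := zeroMult_eq_coe (meromorphicOrderAt_sub_const_ne_top hg hgt a z)
  have h1 : valueMult g a z = m.toNat := hm'
  have h2 : valueMult g ⊤ z = (-n).toNat := by
    change (meromorphicOrderAt (fun w ↦ 1 / g w) z).untop₀.toNat = _
    rw [meromorphicOrderAt_one_div g, hn]
    rfl
  rw [h1, h2, hm, WithTop.untop₀_coe]
  have ha : 0 ≤ meromorphicOrderAt (fun _ : ℂ ↦ -a) z := analyticAt_const.meromorphicOrderAt_nonneg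
  have hadd : (fun w ↦ g w - a) = g + fun _ ↦ -a := by
    ext w
    simp [sub_eq_add_neg]
  rcases lt_or_ge n 0 with hneg | hnonneg
  · have : meromorphicOrderAt (fun w ↦ g w - a) z = meromorphicOrderAt g z := by
      rw [hadd]
      refine meromorphicOrderAt_add_eq_left_of_lt (MeromorphicAt.const _ _) (lt_of_lt_of_le ?_ ha)
      rw [hn]
      exact_mod_cast hneg
    rw [hm, hn] at this
    have h3 : m = n := by exact_mod_cast this
    omega
  · have : 0 ≤ meromorphicOrderAt (fun w ↦ g w - a) z := by
      rw [hadd]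
      refine le_trans (le_min ?_ ha) (meromorphicOrderAt_add (hg z) (MeromorphicAt.const _ _))
      rw [hn]
      exact_mod_cast hnonneg
    rw [hm] at this
    have h3 : 0 ≤ m := by exact_mod_cast this
    omega

/-- If `a` and `∞` are Hahn-Picard values, then `g - a` satisfies a first order homogeneous equation
with rational coefficients. -/
lemma exists_isRationalFun_sub_const (hq0 : 0 < ‖q‖) (hq1 : ‖q‖ < 1) (hg : Meromorphic g)
    (hgt : ¬ IsRationalFun g) (hO : growthOrder g = 0) {a : ℂ}
    (ha : IsHahnPicardValue q c g a) (htop : IsHahnPicardValue q c g ⊤) :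
    ∃ ρ, IsRationalFun ρ ∧ ∀ᶠ z in codiscrete ℂ, g (q * z + c) - a = ρ z * (g z - a) := by
  refine exists_isRationalFun_comp_affine_eq_mul hq0 hq1 (meromorphic_valueFun hg a)
    (meromorphicOrderAt_sub_const_ne_top hg hgt a)
    (isBigO_characteristic_sub_const hg a (isBigO_characteristic_of_growthOrder hO))
    (((ha.finite_setOf_valueMult_ne hq0 hq1 hg hgt).union
      (htop.finite_setOf_valueMult_ne hq0 hq1 hg hgt)).subset fun z hz ↦ ?_)
  by_contra h
  simp only [Set.mem_union, Set.mem_ofPred_eq, not_or, not_not] at h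
  refine hz ?_
  change (meromorphicOrderAt (fun w ↦ g w - a) _).untop₀ =
    (meromorphicOrderAt (fun w ↦ g w - a) _).untop₀
  rw [untop₀_meromorphicOrderAt_sub_const hg hgt, untop₀_meromorphicOrderAt_sub_const hg hgt,
    h.1, h.2]

/-- If `a` and `d` are Hahn-Picard values, then `(g - a) / (g - d)` satisfies a first order
homogeneous equation with rational coefficients. -/
lemma exists_isRationalFun_div (hq0 : 0 < ‖q‖) (hq1 : ‖q‖ < 1) (hg : Meromorphic g)
    (hgt : ¬ IsRationalFun g) (hO : growthOrder g = 0) {a d : ℂ}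
    (ha : IsHahnPicardValue q c g a) (hd : IsHahnPicardValue q c g d) :
    ∃ ρ, IsRationalFun ρ ∧ ∀ᶠ z in codiscrete ℂ,
      (g (q * z + c) - a) / (g (q * z + c) - d) = ρ z * ((g z - a) / (g z - d)) := by
  set A : ℂ → ℂ := fun w ↦ g w - a with hA
  set B : ℂ → ℂ := fun w ↦ g w - d with hB
  have hAm : Meromorphic A := meromorphic_valueFun hg a
  have hBm : Meromorphic B := meromorphic_valueFun hg d
  have hA0 : ∀ z, meromorphicOrderAt A z ≠ ⊤ := meromorphicOrderAt_sub_const_ne_top hg hgt a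
  have hB0 : ∀ z, meromorphicOrderAt B z ≠ ⊤ := meromorphicOrderAt_sub_const_ne_top hg hgt d
  have hOg := isBigO_characteristic_of_growthOrder hO
  have hord : ∀ z, ∃ n m : ℤ, meromorphicOrderAt A z = n ∧ meromorphicOrderAt B z = m ∧
      meromorphicOrderAt (A * B⁻¹) z = (n - m : ℤ) := fun z ↦ by
    obtain ⟨n, hn, -⟩ := zeroMult_eq_coe (hA0 z)
    obtain ⟨m, hm, -⟩ := zeroMult_eq_coe (hB0 z)
    refine ⟨n, m, hn, hm, ?_⟩
    rw [meromorphicOrderAt_mul (hAm z) (hBm z).inv, meromorphicOrderAt_inv, hn, hm, sub_eq_add_neg]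
    rfl
  have hBi : ∀ z, meromorphicOrderAt B⁻¹ z ≠ ⊤ := fun z ↦ by
    obtain ⟨m, hm, -⟩ := zeroMult_eq_coe (hB0 z)
    rw [meromorphicOrderAt_inv, hm]
    exact WithTop.coe_ne_top
  have hval : ∀ z, (meromorphicOrderAt (A * B⁻¹) z).untop₀ =
      (valueMult g a z : ℤ) - valueMult g d z := fun z ↦ by
    obtain ⟨n, m, hn, hm, hnm⟩ := hord z
    have h1 := untop₀_meromorphicOrderAt_sub_const hg hgt a z
    have h2 := untop₀_meromorphicOrderAt_sub_const hg hgt d z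
    rw [← hA, hn, WithTop.untop₀_coe] at h1
    rw [← hB, hm, WithTop.untop₀_coe] at h2
    rw [hnm, WithTop.untop₀_coe]
    omega
  obtain ⟨ρ, hρ, h⟩ := exists_isRationalFun_comp_affine_eq_mul (c := c) hq0 hq1 (hAm.mul hBm.inv)
    (fun z ↦ by obtain ⟨n, m, -, -, hnm⟩ := hord z; rw [hnm]; exact WithTop.coe_ne_top)
    (isBigO_characteristic_mul hAm hBm.inv hA0 hBi (isBigO_characteristic_sub_const hg a hOg)
      (isBigO_characteristic_inv hBm (isBigO_characteristic_sub_const hg d hOg)))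
    (((ha.finite_setOf_valueMult_ne hq0 hq1 hg hgt).union
      (hd.finite_setOf_valueMult_ne hq0 hq1 hg hgt)).subset fun z hz ↦ by
        by_contra h
        simp only [Set.mem_union, Set.mem_ofPred_eq, not_or, not_not] at h
        refine hz ?_
        rw [hval, hval, h.1, h.2])
  refine ⟨ρ, hρ, ?_⟩
  filter_upwards [h] with z hz
  simpa only [Pi.mul_apply, Pi.inv_apply, hA, hB, div_eq_mul_inv] using hz

lemma eventually_sub_const_ne_zero (hg : Meromorphic g) (hgt : ¬ IsRationalFun g) (a : ℂ) :
    ∀ᶠ z in codiscrete ℂ, g z - a ≠ 0 :=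
  MeromorphicOn.eventually_codiscreteWithin_apply_ne_zero (U := Set.univ)
    (fun z _ ↦ meromorphic_valueFun hg a z)
    fun z _ ↦ meromorphicOrderAt_sub_const_ne_top hg hgt a z

theorem not_isHahnPicardValue_coe_coe_top (hq0 : 0 < ‖q‖) (hq1 : ‖q‖ < 1) (hg : Meromorphic g)
    (hgt : ¬ IsRationalFun g) (hO : growthOrder g = 0) {a b : ℂ} (hab : a ≠ b)
    (ha : IsHahnPicardValue q c g a) (hb : IsHahnPicardValue q c g b) :
    ¬ IsHahnPicardValue q c g ⊤ := by
  intro htop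
  obtain ⟨ρ₁, hρ₁, h₁⟩ := exists_isRationalFun_sub_const hq0 hq1 hg hgt hO ha htop
  obtain ⟨ρ₂, hρ₂, h₂⟩ := exists_isRationalFun_sub_const hq0 hq1 hg hgt hO hb htop
  have h := isRationalFun_of_comp_affine_eq_mul (f := fun z ↦ g z - a) (f₂ := fun z ↦ g z - b)
    hq0 hq1 (meromorphic_valueFun hg a) one_ne_zero (sub_ne_zero.mpr hab)
    (Eventually.of_forall fun z ↦ by ring) hρ₁ hρ₂ h₁ h₂
  exact hgt ((h.add (isRationalFun_const a)).congr (Eventually.of_forall fun z ↦ by ring))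

theorem not_isHahnPicardValue_coe_coe_coe (hq0 : 0 < ‖q‖) (hq1 : ‖q‖ < 1) (hg : Meromorphic g)
    (hgt : ¬ IsRationalFun g) (hO : growthOrder g = 0) {a b d : ℂ} (hab : a ≠ b) (had : a ≠ d)
    (hbd : b ≠ d) (ha : IsHahnPicardValue q c g a) (hb : IsHahnPicardValue q c g b) :
    ¬ IsHahnPicardValue q c g d := by
  intro hd
  obtain ⟨ρ₁, hρ₁, h₁⟩ := exists_isRationalFun_div hq0 hq1 hg hgt hO ha hd
  obtain ⟨ρ₂, hρ₂, h₂⟩ := exists_isRationalFun_div hq0 hq1 hg hgt hO hb hd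
  have had' := sub_ne_zero.mpr had
  have hda' := sub_ne_zero.mpr had.symm
  have h := isRationalFun_of_comp_affine_eq_mul (f := fun z ↦ (g z - a) / (g z - d))
    -- From `(a - d) (g - b) = (b - d) (g - a) + (a - b) (g - d)`, divided by `(a - d) (g - d)`.
    (f₂ := fun z ↦ (g z - b) / (g z - d)) (u := (b - d) / (a - d)) (v := (a - b) / (a - d))
    hq0 hq1 ((meromorphic_valueFun hg a).div (meromorphic_valueFun hg d))
    (div_ne_zero (sub_ne_zero.mpr hbd) had') (div_ne_zero (sub_ne_zero.mpr hab) had')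
    (by
      filter_upwards [eventually_sub_const_ne_zero hg hgt d] with z hz
      field_simp
      ring) hρ₁ hρ₂ h₁ h₂
  -- Inverts the Möbius transformation: with `f = (g - a) / (g - d)`, `g = d + (d - a) / (f - 1)`.
  refine hgt (((isRationalFun_const d).add ((isRationalFun_const (d - a)).mul
    (h.sub (isRationalFun_const 1)).inv)).congr ?_)
  filter_upwards [eventually_sub_const_ne_zero hg hgt d] with z hz
  have h1 : (g z - a) / (g z - d) - 1 = (d - a) / (g z - d) := by
    field_simp
    ring
  rw [h1, inv_div, mul_div_cancel₀ _ hda']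
  ring

end Values

end HahnPicard

theorem mainTheorem3 (q c : ℂ) (hq0 : 0 < ‖q‖) (hq1 : ‖q‖ < 1)
    (g : ℂ → ℂ) (hg : Meromorphic g) (hg_transcendental : ¬ HahnPicard.IsRationalFun g)
    (hg_order : HahnPicard.growthOrder g = 0) :
    {a : WithTop ℂ | HahnPicard.IsHahnPicardValue q c g a}.encard ≤ 2 ∧
    ∀ a : WithTop ℂ, ¬ HahnPicard.IsHahnPicardValue q c g a →
      {z : ℂ | 0 < HahnPicard.valueMult g a z}.Infinite := by
  refine ⟨?_, fun a ha hfin ↦ ha (HahnPicard.isHahnPicardValue_of_finite hfin)⟩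
  by_contra! h
  obtain ⟨t, ht, htcard⟩ := Set.exists_subset_encard_eq (Order.add_one_le_of_lt h)
  obtain ⟨x, y, w, hxy, hxw, hyw, rfl⟩ := Set.encard_eq_three.mp (htcard.trans two_add_one_eq_three)
  have hx : HahnPicard.IsHahnPicardValue q c g x := ht (by simp)
  have hy : HahnPicard.IsHahnPicardValue q c g y := ht (by simp)
  have hw : HahnPicard.IsHahnPicardValue q c g w := ht (by simp)
  have htop {a b : ℂ} := HahnPicard.not_isHahnPicardValue_coe_coe_top (c := c) (a := a) (b := b)
    hq0 hq1 hg hg_transcendental hg_order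
  cases x with
  | top =>
    cases y with
    | top => exact hxy rfl
    | coe b =>
      cases w with
      | top => exact hxw rfl
      | coe d => exact htop (fun h ↦ hyw (congrArg _ h)) hy hw hx
  | coe a =>
    cases y with
    | top =>
      cases w with
      | top => exact hyw rfl
      | coe d => exact htop (fun h ↦ hxw (congrArg _ h)) hx hw hy
    | coe b =>
      cases w with
      | top => exact htop (fun h ↦ hxy (congrArg _ h)) hx hy hw
      | coe d =>
        exact HahnPicard.not_isHahnPicardValue_coe_coe_coe hq0 hq1 hg hg_transcendental hg_order
          (fun h ↦ hxy (congrArg _ h)) (fun h ↦ hxw (congrArg _ h))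
          (fun h ↦ hyw (congrArg _ h)) hx hy hw
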